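/- Let $\mathbb{Q}\langle e_0,e_1\rangle$ be the non-commutative polynomial algebra, $\mathfrak{H}^1=\mathbb{Q}+e_1\mathbb{Q}\langle e_0,e_1\rangle$ and $\mathfrak{H}^0=\mathbb{Q}+e_1\mathbb{Q}\langle e_0,e_1\rangle e_0\subset\mathfrak{H}^1$. Put $e_k=e_1e_0^{k-1}$ for $k\ge 1$, and $e_{\boldsymbol{k}}=e_{k_1}\cdots e_{k_r}$ for an index $\boldsymbol{k}=(k_1,\dots,k_r)$ of positive integers ($r\ge 0$, $e_\emptyset=1$); $\boldsymbol{k}$ is admissible if $r=0$ or $k_r>1$. The $e_{\boldsymbol{k}}$ (resp. those with $\boldsymbol{k}$ admissible) form a $\mathbb{Q}$-basis of $\mathfrak{H}^1$ (resp. $\mathfrak{H}^0$). The harmonic product $*$ on $\mathfrak{H}^1$ is the $\mathbb{Q}$-bilinear product with $w*1=1*w=w$ and $$we_{k}*w'e_{l}=(w*w'e_{l})e_{k}+(we_{k}*w')e_{l}+(w*w')e_{k+l}$$ for words $w,w'\in\mathfrak{H}^1$ and $k,l\ge 1$. The shuffle product $\mathbin{\mathrm{sh}}$ on $\mathbb{Q}\langle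 e_0,e_1\rangle$ is the $\mathbb{Q}$-bilinear product with $w\mathbin{\mathrm{sh}}1=1\mathbin{\mathrm{sh}}w=w$ and $$wu\mathbin{\mathrm{sh}}w'u'=(w\mathbin{\mathrm{sh}}w'u')u+(wu\mathbin{\mathrm{sh}}w')u'$$ for words $w,w'$ and $u,u'\in\{e_0,e_1\}$; $\mathfrak{H}^1$ is closed under it. With $*$, $\mathfrak{H}^1$ is a commutative $\mathbb{Q}$-algebra $\mathfrak{H}^1_*$ with $\mathfrak{H}^0$ as a subalgebra $\mathfrak{H}^0_*$, and the $\mathfrak{H}^0_*$-algebra homomorphism $\mathfrak{H}^0_*[T]\to\mathfrak{H}^1_*$, $T\mapsto e_1$, is an isomorphism. Let $\mathrm{reg}_*\colon\mathfrak{H}^1_*\to\mathfrak{H}^0_*$ be its inverse followed by $T\mapsto 0$. Let $Z\colon\mathfrak{H}^0\to\mathbb{R}$ be the $\mathbb{Q}$-linear map with $Z(1)=1$ and $$Z(e_{\boldsymbol{k}})=\zeta(\boldsymbol{k})=\sum_{0<n_1<\cdots<n_r}\frac{1}{n_1^{k_1}\cdots n_r^{k_r}}$$ for every admissible index $\boldsymbol{k}$.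 **Theorem** (harmonic-regularized extended double shuffle relation). For every $w_1\in\mathfrak{H}^1$ and $w_0\in\mathfrak{H}^0$, $$Z\bigl(\mathrm{reg}_*(w_1*w_0-w_1\mathbin{\mathrm{sh}}w_0)\bigr)=0.$$ -/

import Mathlib

noncomputable section

namespace MZV

open Module

/-- The non-commutative polynomial algebra `ℚ⟨e₀, e₁⟩`. -/
abbrev Hoff : Type := FreeAlgebra ℚ (Fin 2)

/-- The two variables `e₀ = e 0` and `e₁ = e 1`. -/
def e (i : Fin 2) : Hoff := FreeAlgebra.ι ℚ i

/-- The word (monomial) `e_{u₁} e_{u₂} ⋯ e_{uₙ}` attached to the list `[u₁, …, uₙ]`. -/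
def word (u : List (Fin 2)) : Hoff := (u.map e).prod

/-- The words form a `ℚ`-basis of `ℚ⟨e₀, e₁⟩`. -/
def wordBasis : Basis (List (Fin 2)) ℚ Hoff :=
  (FreeAlgebra.basisFreeMonoid ℚ (Fin 2)).reindex FreeMonoid.toList

theorem wordBasis_apply (u : List (Fin 2)) : wordBasis u = word u := by
  simp [wordBasis, FreeAlgebra.basisFreeMonoid, FreeAlgebra.equivMonoidAlgebraFreeMonoid, word,
    FreeMonoid.lift_apply]
  rfl

@[simp] theorem word_nil : word [] = 1 := rfl

theorem word_append (u v : List (Fin 2)) : word (u ++ v) = word u * word v := by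
  simp [word]

theorem word_concat (u : List (Fin 2)) (a : Fin 2) : word (u ++ [a]) = word u * e a := by
  simp [word]

theorem word_cons (u : List (Fin 2)) (a : Fin 2) : word (a :: u) = e a * word u := by
  simp [word]

/-- `𝔥¹ = ℚ + e₁ ℚ⟨e₀, e₁⟩`. -/
def H1 : Submodule ℚ Hoff :=
  Submodule.span ℚ {1} ⊔ LinearMap.range (LinearMap.mulLeft ℚ (e 1))

/-- `𝔥⁰ = ℚ + e₁ ℚ⟨e₀, e₁⟩ e₀`. -/
def H0 : Submodule ℚ Hoff :=
  Submodule.span ℚ {1} ⊔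
    LinearMap.range (LinearMap.mulLeft ℚ (e 1) ∘ₗ LinearMap.mulRight ℚ (e 0))

theorem H0_le_H1 : H0 ≤ H1 := by
  refine sup_le_sup_left ?_ _
  rintro _ ⟨x, rfl⟩
  exact ⟨x * e 0, rfl⟩

/-- For an index `k = (k₁, …, k_r)` this is `e_{k₁} ⋯ e_{k_r}` where `e_k = e₁ e₀^{k-1}`. -/
def eIdx (k : List ℕ+) : Hoff := (k.map fun a : ℕ+ => e 1 * e 0 ^ ((a : ℕ) - 1)).prod

/-- An index is admissible if it is empty or its last entry is greater than `1`. -/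
def Admissible (k : List ℕ+) : Prop := ∀ a ∈ k.getLast?, 1 < a

/-- The letters of the word `eIdx k`. -/
def idxLetters (k : List ℕ+) : List (Fin 2) :=
  (k.map fun a : ℕ+ => (1 : Fin 2) :: List.replicate ((a : ℕ) - 1) 0).flatten

theorem eIdx_eq_word (k : List ℕ+) : eIdx k = word (idxLetters k) := by
  induction k with
  | nil => rfl
  | cons a k ih =>
    have h : word (List.replicate ((a : ℕ) - 1) 0) = e 0 ^ ((a : ℕ) - 1) := by
      simp [word]
    rw [idxLetters, List.map_cons, List.flatten_cons, word_append, word_cons, h]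
    rw [eIdx, List.map_cons, List.prod_cons]
    congr 1

theorem idxLetters_injective : Function.Injective idxLetters := by
  let step : List ℕ+ → Fin 2 → List ℕ+ := fun acc u =>
    if u = 1 then 1 :: acc else acc.modifyHead (· + 1)
  have h0 : ∀ (n : ℕ) (a : ℕ+) (acc : List ℕ+),
      (List.replicate n (0 : Fin 2)).foldl step (a :: acc) =
        Nat.toPNat' (a + n) :: acc := by
    intro n
    induction n with
    | zero => intro a acc; simp
    | succ n ih =>
      intro a acc
      simp only [List.replicate_succ, List.foldl_cons]
      have : step (a :: acc) 0 = (a + 1) :: acc := by simp [step]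
      rw [this, ih]
      congr 1
      apply PNat.coe_injective
      have := a.pos
      simp [Nat.toPNat'_coe]
      omega
  have h1 : ∀ (k acc : List ℕ+), (idxLetters k).foldl step acc = k.reverse ++ acc := by
    intro k
    induction k with
    | nil => intro acc; rfl
    | cons a k ih =>
      intro acc
      have h2 : idxLetters (a :: k) =
          1 :: (List.replicate ((a : ℕ) - 1) 0 ++ idxLetters k) := by simp [idxLetters]
      have h3 : step acc 1 = 1 :: acc := by simp [step]
      rw [h2, List.foldl_cons, List.foldl_append, h3, h0, ih]
      simp only [List.reverse_cons, List.append_assoc, List.cons_append, List.nil_append]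
      congr 2
      apply PNat.coe_injective
      have := a.pos
      simp [Nat.toPNat'_coe]
      omega
  intro k l hkl
  have := h1 k []
  rw [hkl, h1 l []] at this
  simpa using this.symm

theorem linearIndependent_eIdx : LinearIndependent ℚ eIdx := by
  have : eIdx = wordBasis ∘ idxLetters := by
    funext k
    simp [eIdx_eq_word, wordBasis_apply]
  rw [this]
  exact wordBasis.linearIndependent.comp _ idxLetters_injective

theorem eIdx_concat (k : List ℕ+) (a : ℕ+) :
    eIdx (k ++ [a]) = eIdx k * (e 1 * e 0 ^ ((a : ℕ) - 1)) := by
  simp [eIdx]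

theorem eIdx_concat_mul_e0 (k : List ℕ+) (a : ℕ+) :
    eIdx (k ++ [a]) * e 0 = eIdx (k ++ [a + 1]) := by
  have : ((a + 1 : ℕ+) : ℕ) - 1 = ((a : ℕ) - 1) + 1 := by
    have := a.pos
    simp
    omega
  rw [eIdx_concat, eIdx_concat, this, pow_succ]
  simp [mul_assoc]

theorem exists_eIdx (u : List (Fin 2)) : ∃ k a, e 1 * word u = eIdx (k ++ [a]) := by
  induction u using List.reverseRecOn with
  | nil => exact ⟨[], 1, by simp [eIdx]⟩
  | append_singleton u b ih =>
    obtain ⟨k, a, h⟩ := ih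
    rw [word_concat, ← mul_assoc, h]
    fin_cases b
    · exact ⟨k, a + 1, eIdx_concat_mul_e0 k a⟩
    · exact ⟨k ++ [a], 1, by rw [eIdx_concat (k ++ [a])]; simp⟩

theorem eIdx_mem_H1 (k : List ℕ+) : eIdx k ∈ H1 := by
  cases k with
  | nil => exact Submodule.mem_sup_left (Submodule.mem_span_singleton_self _)
  | cons a k =>
    refine Submodule.mem_sup_right ⟨e 0 ^ ((a : ℕ) - 1) * eIdx k, ?_⟩
    simp [eIdx, mul_assoc]

theorem H1_eq_span : H1 = Submodule.span ℚ (Set.range eIdx) := by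
  apply le_antisymm
  · refine sup_le ?_ ?_
    · rw [Submodule.span_le, Set.singleton_subset_iff]
      exact Submodule.subset_span ⟨[], rfl⟩
    · rw [← Submodule.map_top, ← wordBasis.span_eq, Submodule.map_span, Submodule.span_le]
      rintro _ ⟨_, ⟨u, rfl⟩, rfl⟩
      obtain ⟨k, a, h⟩ := exists_eIdx u
      rw [LinearMap.mulLeft_apply, wordBasis_apply, h]
      exact Submodule.subset_span ⟨_, rfl⟩
  · rw [Submodule.span_le]
    rintro _ ⟨k, rfl⟩
    exact eIdx_mem_H1 k

theorem eIdx_mem_H0 {k : List ℕ+} (hk : Admissible k) : eIdx k ∈ H0 := by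
  rcases List.eq_nil_or_concat k with rfl | ⟨l, a, rfl⟩
  · exact Submodule.mem_sup_left (Submodule.mem_span_singleton_self _)
  · have ha : 1 < a := hk a (by simp)
    obtain ⟨b, rfl⟩ : ∃ b : ℕ+, a = b + 1 := ⟨a - 1, (PNat.sub_add_of_lt ha).symm⟩
    rw [List.concat_eq_append, ← eIdx_concat_mul_e0]
    refine Submodule.mem_sup_right ?_
    cases l with
    | nil => exact ⟨e 0 ^ ((b : ℕ) - 1), by simp [eIdx, mul_assoc]⟩
    | cons c l =>
      exact ⟨e 0 ^ ((c : ℕ) - 1) * eIdx (l ++ [b]), by simp [eIdx, mul_assoc]⟩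

theorem H0_eq_span : H0 = Submodule.span ℚ (eIdx '' {k | Admissible k}) := by
  apply le_antisymm
  · refine sup_le ?_ ?_
    · rw [Submodule.span_le, Set.singleton_subset_iff]
      exact Submodule.subset_span ⟨[], by simp [Admissible], rfl⟩
    · rw [← Submodule.map_top, ← wordBasis.span_eq, Submodule.map_span, Submodule.span_le]
      rintro _ ⟨_, ⟨u, rfl⟩, rfl⟩
      obtain ⟨k, a, h⟩ := exists_eIdx u
      rw [LinearMap.comp_apply, LinearMap.mulLeft_apply, LinearMap.mulRight_apply,
        wordBasis_apply, ← mul_assoc, h, eIdx_concat_mul_e0]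
      refine Submodule.subset_span ⟨_, ?_, rfl⟩
      intro b hb
      simp only [List.getLast?_append, List.getLast?_singleton, Option.some_or,
        Option.mem_def, Option.some.injEq] at hb
      rw [← hb]
      exact PNat.lt_add_left 1 a
  · rw [Submodule.span_le]
    rintro _ ⟨k, hk, rfl⟩
    exact eIdx_mem_H0 hk

/-- The elements `e_k`, for `k` running through all indices, form a basis of `𝔥¹`. -/
def basisH1 : Basis (List ℕ+) ℚ H1 :=
  (Basis.span linearIndependent_eIdx).map (LinearEquiv.ofEq _ _ H1_eq_span.symm)

theorem coe_basisH1 (k : List ℕ+) : (basisH1 k : Hoff) = eIdx k := by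
  simp [basisH1, Basis.span_apply]

/-- The shuffle product of two words, recursively by the last letters; the words are given by
their lists of letters read from right to left. -/
def shRev : List (Fin 2) → List (Fin 2) → Hoff
  | [], v => word v.reverse
  | u, [] => word u.reverse
  | a :: u, b :: v => shRev u (b :: v) * e a + shRev (a :: u) v * e b
termination_by u v => u.length + v.length

/-- The shuffle product on `ℚ⟨e₀, e₁⟩`. -/
def sh : Hoff →ₗ[ℚ] Hoff →ₗ[ℚ] Hoff :=
  wordBasis.constr ℚ fun u => wordBasis.constr ℚ fun v => shRev u.reverse v.reverse

theorem sh_word (u v : List (Fin 2)) : sh (word u) (word v) = shRev u.reverse v.reverse := by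
  rw [← wordBasis_apply, ← wordBasis_apply, sh, Basis.constr_basis, Basis.constr_basis]

theorem one_sh (x : Hoff) : sh 1 x = x := by
  have : sh 1 = LinearMap.id := wordBasis.ext fun v => by
    rw [wordBasis_apply, ← word_nil, sh_word]
    simp [shRev]
  simp [this]

theorem sh_one (x : Hoff) : sh x 1 = x := by
  have : sh.flip 1 = LinearMap.id := wordBasis.ext fun v => by
    rw [wordBasis_apply, LinearMap.flip_apply, ← word_nil, sh_word]
    cases v.reverse.eq_nil_or_concat <;> cases h : v.reverse <;> simp_all [shRev]
  simpa using LinearMap.congr_fun this x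

theorem sh_mul_mul (x y : Hoff) (a b : Fin 2) :
    sh (x * e a) (y * e b) = sh x (y * e b) * e a + sh (x * e a) y * e b := by
  have key : sh.compl₁₂ (LinearMap.mulRight ℚ (e a)) (LinearMap.mulRight ℚ (e b)) =
      (sh.compl₁₂ LinearMap.id (LinearMap.mulRight ℚ (e b))).compr₂ (LinearMap.mulRight ℚ (e a)) +
      (sh.compl₁₂ (LinearMap.mulRight ℚ (e a)) LinearMap.id).compr₂
        (LinearMap.mulRight ℚ (e b)) := by
    refine wordBasis.ext fun u => wordBasis.ext fun v => ?_
    simp only [wordBasis_apply, LinearMap.compl₁₂_apply, LinearMap.mulRight_apply,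
      LinearMap.add_apply, LinearMap.compr₂_apply, LinearMap.id_apply, ← word_concat, sh_word,
      List.reverse_append, List.reverse_cons, List.reverse_nil, List.nil_append,
      List.cons_append]
    rw [shRev]
  simpa using LinearMap.congr_fun (LinearMap.congr_fun key x) y

theorem shRev_mem (u v : List (Fin 2)) (hu : ∀ a ∈ u.getLast?, a = 1)
    (hv : ∀ a ∈ v.getLast?, a = 1) (huv : u ≠ [] ∨ v ≠ []) :
    shRev u v ∈ LinearMap.range (LinearMap.mulLeft ℚ (e 1)) := by
  have hw : ∀ w : List (Fin 2), (∀ a ∈ w.getLast?, a = 1) → w ≠ [] →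
      word w.reverse ∈ LinearMap.range (LinearMap.mulLeft ℚ (e 1)) := by
    intro w hw hne
    obtain rfl | ⟨l, a, rfl⟩ := w.eq_nil_or_concat
    · exact absurd rfl hne
    · obtain rfl : a = 1 := hw a (by simp)
      exact ⟨word l.reverse, by simp [word_cons]⟩
  have hmul : ∀ (x : Hoff) (a : Fin 2), x ∈ LinearMap.range (LinearMap.mulLeft ℚ (e 1)) →
      x * e a ∈ LinearMap.range (LinearMap.mulLeft ℚ (e 1)) := by
    rintro _ a ⟨x, rfl⟩
    exact ⟨x * e a, by simp [mul_assoc]⟩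
  have htail : ∀ (a : Fin 2) (w : List (Fin 2)), (∀ b ∈ (a :: w).getLast?, b = 1) →
      ∀ b ∈ w.getLast?, b = 1 := by
    intro a w h b hb
    apply h
    cases w with
    | nil => simp at hb
    | cons c w => simpa using hb
  induction u, v using shRev.induct with
  | case1 v => rw [shRev]; exact hw v hv (by simpa using huv)
  | case2 u hne => rw [shRev]; exacts [hw u hu (by simpa using huv), hne]
  | case3 a u b v ih1 ih2 =>
    rw [shRev]
    exact add_mem (hmul _ _ (ih1 (htail _ _ hu) hv (by simp)))
      (hmul _ _ (ih2 hu (htail _ _ hv) (by simp)))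

/-- `𝔥¹` is closed under the shuffle product. -/
theorem sh_mem_H1 {x y : Hoff} (hx : x ∈ H1) (hy : y ∈ H1) : sh x y ∈ H1 := by
  have hE : ∀ x ∈ H1, x ∈ Submodule.span ℚ
      (word '' {u : List (Fin 2) | ∀ a ∈ u.reverse.getLast?, a = 1}) := by
    intro x hx
    rw [H1_eq_span] at hx
    refine Submodule.span_mono ?_ hx
    rintro _ ⟨k, rfl⟩
    refine ⟨idxLetters k, ?_, (eIdx_eq_word k).symm⟩
    cases k <;> simp [idxLetters]
  have h := Submodule.apply_mem_map₂ sh (hE x hx) (hE y hy)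
  rw [Submodule.map₂_span_span] at h
  refine Submodule.span_le.2 ?_ h
  rintro _ ⟨_, ⟨u, hu, rfl⟩, _, ⟨v, hv, rfl⟩, rfl⟩
  change sh (word u) (word v) ∈ H1
  rw [sh_word]
  by_cases huv : u.reverse ≠ [] ∨ v.reverse ≠ []
  · exact Submodule.mem_sup_right (shRev_mem _ _ hu hv huv)
  · push Not at huv
    rw [huv.1, huv.2, shRev]
    exact Submodule.mem_sup_left (Submodule.mem_span_singleton_self _)

/-- The shuffle product on `𝔥¹`. -/
def shH1 (x y : H1) : H1 := ⟨sh x y, sh_mem_H1 x.2 y.2⟩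

/-- Concatenation with `e_a` on the right, `w ↦ w e_a`, on `𝔥¹`. -/
def appendE (a : ℕ+) : H1 →ₗ[ℚ] H1 :=
  (LinearMap.mulRight ℚ (e 1 * e 0 ^ ((a : ℕ) - 1))).restrict (by
    intro x hx
    rw [H1_eq_span] at hx
    have h := Submodule.mem_map_of_mem
      (f := LinearMap.mulRight ℚ (e 1 * e 0 ^ ((a : ℕ) - 1))) hx
    rw [Submodule.map_span] at h
    refine Submodule.span_le.2 ?_ h
    rintro _ ⟨_, ⟨k, rfl⟩, rfl⟩
    rw [LinearMap.mulRight_apply, ← eIdx_concat]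
    exact eIdx_mem_H1 _)

theorem appendE_basis (a : ℕ+) (k : List ℕ+) :
    appendE a (basisH1 k) = basisH1 (k ++ [a]) := by
  apply Subtype.ext
  rw [coe_basisH1, eIdx_concat, ← coe_basisH1 k]
  rfl

/-- The harmonic product of `e_k` and `e_l`, recursively by the last entries; the indices are
given by their lists of entries read from right to left. -/
def harmRev : List ℕ+ → List ℕ+ → H1
  | [], l => basisH1 l.reverse
  | k, [] => basisH1 k.reverse
  | a :: k, b :: l =>
    appendE a (harmRev k (b :: l)) + appendE b (harmRev (a :: k) l) +
      appendE (a + b) (harmRev k l)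
termination_by k l => k.length + l.length

/-- The harmonic product on `𝔥¹`. -/
def harm : H1 →ₗ[ℚ] H1 →ₗ[ℚ] H1 :=
  basisH1.constr ℚ fun k => basisH1.constr ℚ fun l => harmRev k.reverse l.reverse

theorem harm_basis (k l : List ℕ+) :
    harm (basisH1 k) (basisH1 l) = harmRev k.reverse l.reverse := by
  rw [harm, Basis.constr_basis, Basis.constr_basis]

/-- The unit `1 ∈ 𝔥¹`. -/
def oneH1 : H1 := ⟨1, Submodule.mem_sup_left (Submodule.mem_span_singleton_self _)⟩

theorem basisH1_nil : basisH1 [] = oneH1 := Subtype.ext (coe_basisH1 [])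

theorem one_harm (x : H1) : harm oneH1 x = x := by
  have : harm oneH1 = LinearMap.id := basisH1.ext fun v => by
    rw [← basisH1_nil, harm_basis]
    simp [harmRev]
  simp [this]

theorem harm_one (x : H1) : harm x oneH1 = x := by
  have : harm.flip oneH1 = LinearMap.id := basisH1.ext fun v => by
    rw [LinearMap.flip_apply, ← basisH1_nil, harm_basis]
    cases v.reverse.eq_nil_or_concat <;> cases h : v.reverse <;> simp_all [harmRev]
  simpa using LinearMap.congr_fun this x

theorem harm_append_append (x y : H1) (a b : ℕ+) :
    harm (appendE a x) (appendE b y) =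
      appendE a (harm x (appendE b y)) + appendE b (harm (appendE a x) y) +
        appendE (a + b) (harm x y) := by
  have key : harm.compl₁₂ (appendE a) (appendE b) =
      (harm.compl₁₂ LinearMap.id (appendE b)).compr₂ (appendE a) +
      (harm.compl₁₂ (appendE a) LinearMap.id).compr₂ (appendE b) +
      harm.compr₂ (appendE (a + b)) := by
    refine basisH1.ext fun u => basisH1.ext fun v => ?_
    simp only [LinearMap.compl₁₂_apply, LinearMap.add_apply, LinearMap.compr₂_apply,
      LinearMap.id_apply, appendE_basis, harm_basis,
      List.reverse_append, List.reverse_cons, List.reverse_nil, List.nil_append,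
      List.cons_append]
    rw [harmRev]
  simpa using LinearMap.congr_fun (LinearMap.congr_fun key x) y

theorem harm_comm (x y : H1) : harm x y = harm y x := by
  have h : ∀ k l : List ℕ+, harmRev k l = harmRev l k := by
    intro k l
    induction k, l using harmRev.induct with
    | case1 l => cases l <;> simp [harmRev]
    | case2 k hk => cases k <;> simp [harmRev]
    | case3 a k b l ih1 ih2 ih3 =>
      rw [harmRev, harmRev, ih1, ih2, ih3, add_comm b a]
      abel
  have key : harm = harm.flip := basisH1.ext fun u => basisH1.ext fun v => by
    rw [LinearMap.flip_apply, harm_basis, harm_basis, h]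
  exact LinearMap.congr_fun (LinearMap.congr_fun key x) y

theorem basisH1_concat (k : List ℕ+) (a : ℕ+) :
    basisH1 (k ++ [a]) = appendE a (basisH1 k) := (appendE_basis a k).symm

theorem harm_assoc (x y z : H1) : harm (harm x y) z = harm x (harm y z) := by
  have h : ∀ (n : ℕ) (k l m : List ℕ+), k.length + l.length + m.length ≤ n →
      harm (harm (basisH1 k) (basisH1 l)) (basisH1 m) =
        harm (basisH1 k) (harm (basisH1 l) (basisH1 m)) := by
    intro n
    induction n with
    | zero =>
      intro k l m h
      obtain rfl : k = [] := List.length_eq_zero_iff.1 (by omega)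
      rw [basisH1_nil, one_harm, one_harm]
    | succ n ih =>
      intro k l m h
      obtain rfl | ⟨k, a, rfl⟩ := k.eq_nil_or_concat
      · rw [basisH1_nil, one_harm, one_harm]
      obtain rfl | ⟨l, b, rfl⟩ := l.eq_nil_or_concat
      · rw [basisH1_nil, one_harm, harm_one]
      obtain rfl | ⟨m, c, rfl⟩ := m.eq_nil_or_concat
      · rw [basisH1_nil, harm_one, harm_one]
      simp only [List.concat_eq_append, List.length_append, List.length_cons,
        List.length_nil] at h ⊢
      have i1 := ih k (l ++ [b]) (m ++ [c]) (by simp; omega)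
      have i2 := ih (k ++ [a]) l (m ++ [c]) (by simp; omega)
      have i3 := ih (k ++ [a]) (l ++ [b]) m (by simp; omega)
      have i4 := ih k l (m ++ [c]) (by simp; omega)
      have i5 := ih k (l ++ [b]) m (by simp; omega)
      have i6 := ih (k ++ [a]) l m (by simp; omega)
      have i7 := ih k l m (by omega)
      simp only [basisH1_concat] at *
      generalize basisH1 k = u at *
      generalize basisH1 l = v at *
      generalize basisH1 m = w at *
      simp only [harm_append_append, map_add, LinearMap.add_apply] at *
      rw [i1, i2, i4, i5, i6, i7, add_assoc a b c]
      have j3 := congrArg (appendE c) i3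
      simp only [map_add] at j3 ⊢
      linear_combination (norm := module) j3
  let L : H1 →ₗ[ℚ] H1 →ₗ[ℚ] H1 →ₗ[ℚ] H1 := harm.compr₂ harm
  let R : H1 →ₗ[ℚ] H1 →ₗ[ℚ] H1 →ₗ[ℚ] H1 :=
    (LinearMap.llcomp ℚ H1 H1 H1 ∘ₗ harm).compl₂ harm
  have key : L = R := basisH1.ext fun k => basisH1.ext fun l => basisH1.ext fun m =>
    h _ k l m le_rfl
  exact LinearMap.congr_fun (LinearMap.congr_fun (LinearMap.congr_fun key x) y) z

/-- The commutative `ℚ`-algebra `𝔥¹_*`: the space `𝔥¹` with the harmonic product. -/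
def H1Star : Type := H1

instance : AddCommGroup H1Star := inferInstanceAs (AddCommGroup H1)

instance : Module ℚ H1Star := inferInstanceAs (Module ℚ H1)

instance : CommRing H1Star :=
  { (inferInstance : AddCommGroup H1Star) with
    mul := fun x y => harm x y
    one := oneH1
    mul_assoc := harm_assoc
    mul_comm := harm_comm
    one_mul := one_harm
    mul_one := harm_one
    left_distrib := fun x y z => map_add (harm x) y z
    right_distrib := fun x y z => LinearMap.map_add₂ harm x y z
    zero_mul := fun x => LinearMap.map_zero₂ harm x
    mul_zero := fun x => map_zero (harm x) }

instance : Algebra ℚ H1Star :=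
  Algebra.ofModule (fun r x y => LinearMap.map_smul₂ harm r x y)
    (fun r x y => map_smul (harm x) r y)

/-- The identity map `𝔥¹ → 𝔥¹_*`. -/
def toStar : H1 ≃ₗ[ℚ] H1Star := LinearEquiv.refl ℚ H1

theorem toStar_mul (x y : H1) : toStar x * toStar y = toStar (harm x y) := rfl

theorem toStar_one : toStar oneH1 = 1 := rfl

theorem appendE_mem_H0 (x : H1) {a : ℕ+} (ha : 1 < a) : (appendE a x : Hoff) ∈ H0 := by
  have hx : x ∈ Submodule.span ℚ (Set.range basisH1) := by simp [basisH1.span_eq]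
  induction hx using Submodule.span_induction with
  | mem x h =>
    obtain ⟨k, rfl⟩ := h
    rw [appendE_basis, coe_basisH1]
    exact eIdx_mem_H0 (by intro b hb; simp at hb; rwa [← hb])
  | zero => simp
  | add x y _ _ hx hy => simpa using add_mem hx hy
  | smul c x _ hx => simpa using H0.smul_mem c hx

/-- Induction on `𝔥⁰`. -/
theorem H0_induction {p : H1 → Prop} (one : p oneH1)
    (app : ∀ x a, 1 < a → p (appendE a x)) (add : ∀ x y, p x → p y → p (x + y))
    (smul : ∀ (c : ℚ) x, p x → p (c • x)) {x : H1} (hx : (x : Hoff) ∈ H0) : p x := by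
  have zero : p 0 := by simpa using smul 0 _ one
  obtain ⟨x, hx1⟩ := x
  change x ∈ H0 at hx
  rw [H0_eq_span] at hx
  have hle : ∀ x ∈ Submodule.span ℚ (eIdx '' {k | Admissible k}), x ∈ H1 := fun x h =>
    H0_le_H1 (by rwa [H0_eq_span])
  induction hx using Submodule.span_induction with
  | mem x h =>
    obtain ⟨k, hk, rfl⟩ := h
    obtain rfl | ⟨k, a, rfl⟩ := k.eq_nil_or_concat
    · exact one
    · have : (⟨eIdx (k.concat a), hx1⟩ : H1) = appendE a (basisH1 k) := by
        rw [appendE_basis]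
        exact Subtype.ext (by simp [coe_basisH1])
      rw [this]
      exact app _ _ (hk a (by simp))
  | zero => exact zero
  | add x y hx hy ihx ihy => exact add _ _ (ihx (hle x hx)) (ihy (hle y hy))
  | smul c x hx ihx => exact smul c _ (ihx (hle x hx))

theorem harm_mem_H0 {x y : H1} (hx : (x : Hoff) ∈ H0) (hy : (y : Hoff) ∈ H0) :
    (harm x y : Hoff) ∈ H0 := by
  refine H0_induction (p := fun x => (harm x y : Hoff) ∈ H0) ?_ ?_ ?_ ?_ hx
  · rwa [one_harm]
  · intro x a ha
    refine H0_induction (p := fun y => (harm (appendE a x) y : Hoff) ∈ H0) ?_ ?_ ?_ ?_ hy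
    · rw [harm_one]
      exact appendE_mem_H0 x ha
    · intro y b hb
      rw [harm_append_append]
      exact add_mem (add_mem (appendE_mem_H0 _ ha) (appendE_mem_H0 _ hb))
        (appendE_mem_H0 _ (ha.trans (PNat.lt_add_right a b)))
    · intro y z h1 h2
      simpa using add_mem h1 h2
    · intro c y h
      simpa using H0.smul_mem c h
  · intro y z h1 h2
    simpa using add_mem h1 h2
  · intro c y h
    simpa using H0.smul_mem c h

/-- The subalgebra `𝔥⁰_*` of `𝔥¹_*`. -/
def H0Star : Subalgebra ℚ H1Star where
  carrier := {x | ((toStar.symm x : H1) : Hoff) ∈ H0}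
  mul_mem' hx hy := harm_mem_H0 hx hy
  add_mem' hx hy := H0.add_mem hx hy
  algebraMap_mem' r := by
    rw [Algebra.algebraMap_eq_smul_one]
    exact H0.smul_mem r (Submodule.mem_sup_left (Submodule.mem_span_singleton_self _))

theorem mem_H0Star {x : H1} : toStar x ∈ H0Star ↔ (x : Hoff) ∈ H0 := Iff.rfl

/-- The element `e₁` of `𝔥¹_*`. -/
def e1Star : H1Star := toStar ⟨e 1, Submodule.mem_sup_right ⟨1, by simp⟩⟩

theorem e1Star_eq : e1Star = toStar (appendE 1 oneH1) := by
  refine congrArg toStar (Subtype.ext ?_)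
  simp [appendE, oneH1]

/-- The homomorphism `𝔥⁰_*[T] → 𝔥¹_*` which is the identity on `𝔥⁰_*` and sends `T` to `e₁`. -/
def fromPoly : Polynomial H0Star →ₐ[H0Star] H1Star := Polynomial.aeval e1Star

/-- The linear map removing the last letter `e₁` of `w e₁`, and vanishing on `𝔥⁰`. -/
def dropE1 : H1 →ₗ[ℚ] H1 :=
  basisH1.constr ℚ fun k => if k.getLast? = some 1 then basisH1 k.dropLast else 0

theorem dropE1_one : dropE1 oneH1 = 0 := by
  rw [← basisH1_nil, dropE1, Basis.constr_basis]
  simp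

theorem dropE1_append (a : ℕ+) (x : H1) : dropE1 (appendE a x) = if a = 1 then x else 0 := by
  have : dropE1 ∘ₗ appendE a = if a = 1 then LinearMap.id else 0 := basisH1.ext fun k => by
    rw [LinearMap.comp_apply, appendE_basis, dropE1, Basis.constr_basis]
    split_ifs <;> simp_all
  have h := LinearMap.congr_fun this x
  rw [LinearMap.comp_apply] at h
  rw [h]
  split_ifs <;> simp

theorem dropE1_H0 {x : H1} (hx : (x : Hoff) ∈ H0) : dropE1 x = 0 := by
  refine H0_induction (p := fun x => dropE1 x = 0) dropE1_one ?_ ?_ ?_ hx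
  · intro x a ha
    rw [dropE1_append, if_neg ha.ne']
  · intro x y hx hy
    rw [map_add, hx, hy, add_zero]
  · intro c x hx
    rw [map_smul, hx, smul_zero]

/-- Induction on `𝔥¹`. -/
theorem H1_induction {p : H1 → Prop} (one : p oneH1)
    (app : ∀ x a, p x → p (appendE a x)) (add : ∀ x y, p x → p y → p (x + y))
    (smul : ∀ (c : ℚ) x, p x → p (c • x)) (x : H1) : p x := by
  have hx : x ∈ Submodule.span ℚ (Set.range basisH1) := by simp [basisH1.span_eq]
  induction hx using Submodule.span_induction with
  | mem x h =>
    obtain ⟨k, rfl⟩ := h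
    induction k using List.reverseRecOn with
    | nil => rw [basisH1_nil]; exact one
    | append_singleton k a ih => rw [basisH1_concat]; exact app _ _ ih
  | zero => simpa using smul 0 _ one
  | add x y _ _ hx hy => exact add _ _ hx hy
  | smul c x _ hx => exact smul _ _ hx

theorem sub_mem_H0 (x : H1) : ((x - appendE 1 (dropE1 x) : H1) : Hoff) ∈ H0 := by
  refine H1_induction (p := fun x => ((x - appendE 1 (dropE1 x) : H1) : Hoff) ∈ H0)
    ?_ ?_ ?_ ?_ x
  · rw [dropE1_one, map_zero, sub_zero]
    exact Submodule.mem_sup_left (Submodule.mem_span_singleton_self _)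
  · intro x a _
    rw [dropE1_append]
    split_ifs with h
    · rw [h, sub_self]
      exact H0.zero_mem
    · rw [map_zero, sub_zero]
      exact appendE_mem_H0 x (lt_of_le_of_ne (one_le (a := a)) (Ne.symm h))
  · intro x y hx hy
    have : x + y - appendE 1 (dropE1 (x + y)) =
      (x - appendE 1 (dropE1 x)) + (y - appendE 1 (dropE1 y)) := by
      simp only [map_add]
      abel
    rw [this]
    exact H0.add_mem hx hy
  · intro c x hx
    have : c • x - appendE 1 (dropE1 (c • x)) = c • (x - appendE 1 (dropE1 x)) := by
      simp only [map_smul, smul_sub]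
    rw [this]
    exact H0.smul_mem c hx

theorem mem_H0_of_dropE1 {x : H1} (hx : dropE1 x = 0) : (x : Hoff) ∈ H0 := by
  have := sub_mem_H0 x
  rwa [hx, map_zero, sub_zero] at this

theorem dropE1_harm (x y : H1) :
    dropE1 (harm x y) = harm x (dropE1 y) + harm y (dropE1 x) := by
  refine H1_induction (p := fun x => dropE1 (harm x y) = harm x (dropE1 y) + harm y (dropE1 x))
    ?_ ?_ ?_ ?_ x
  · simp [one_harm, dropE1_one]
  · intro x a _
    refine H1_induction (p := fun y => dropE1 (harm (appendE a x) y) =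
      harm (appendE a x) (dropE1 y) + harm y (dropE1 (appendE a x))) ?_ ?_ ?_ ?_ y
    · simp [harm_one, one_harm, dropE1_one]
    · intro y b _
      have hab : a + b ≠ 1 := (lt_of_le_of_lt (one_le (a := a)) (PNat.lt_add_right a b)).ne'
      simp only [harm_append_append, map_add, dropE1_append, if_neg hab, add_zero]
      rw [add_comm]
      split_ifs <;> simp [harm_comm]
    · intro y z h1 h2
      simp only [map_add, h1, h2, LinearMap.add_apply]
      abel
    · intro c y h
      simp only [map_smul, h, LinearMap.smul_apply, smul_add]
  · intro x z h1 h2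
    simp only [map_add, h1, h2, LinearMap.add_apply]
    abel
  · intro c x h
    simp only [map_smul, h, LinearMap.smul_apply, smul_add]

/-- `dropE1` is an `𝔥⁰_*`-linear derivation of `𝔥¹_*`. -/
def derivE1 : Derivation H0Star H1Star H1Star where
  toFun x := toStar (dropE1 (toStar.symm x))
  map_add' x y := map_add dropE1 _ _
  map_smul' c x := by
    have h := dropE1_harm (toStar.symm c.1) (toStar.symm x)
    rw [dropE1_H0 c.2, map_zero, add_zero] at h
    exact h
  map_one_eq_zero' := dropE1_one
  leibniz' x y := dropE1_harm x y

theorem derivE1_e1 : derivE1 e1Star = 1 := by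
  change toStar (dropE1 (toStar.symm e1Star)) = 1
  rw [e1Star_eq, LinearEquiv.symm_apply_apply, dropE1_append, if_pos rfl, toStar_one]

theorem derivE1_fromPoly (p : Polynomial H0Star) :
    derivE1 (fromPoly p) = fromPoly p.derivative := by
  rw [fromPoly, Derivation.map_aeval, derivE1_e1, smul_eq_mul, mul_one]

theorem fromPoly_C (c : H0Star) : fromPoly (Polynomial.C c) = c.1 := by
  rw [fromPoly, Polynomial.aeval_C]
  rfl

theorem fromPoly_injective : Function.Injective fromPoly := by
  have : IsAddTorsionFree H0Star := IsAddTorsionFree.of_module_rat H0Star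
  rw [injective_iff_map_eq_zero]
  intro p
  induction h : p.natDegree using Nat.strong_induction_on generalizing p with
  | _ n ih =>
    intro hp
    have key : ∀ c : H0Star, p = Polynomial.C c → p = 0 := by
      rintro c rfl
      rw [fromPoly_C] at hp
      rw [show c = 0 from Subtype.ext hp, Polynomial.C_0]
    rcases Nat.eq_zero_or_pos n with rfl | hn
    · exact key _ (Polynomial.eq_C_of_natDegree_eq_zero h)
    · have hd : p.derivative = 0 := by
        refine ih _ (h ▸ Polynomial.natDegree_derivative_lt (by omega)) _ rfl ?_
        rw [← derivE1_fromPoly, hp, map_zero]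
      exact key _ (Polynomial.eq_C_of_natDegree_eq_zero
        (Polynomial.derivative_eq_zero.1 hd))

theorem fromPoly_surjective : Function.Surjective fromPoly := by
  have hnil : ∀ x : H1, ∃ n, (dropE1 ^ n) x = 0 := by
    intro x
    refine H1_induction (p := fun x => ∃ n, (dropE1 ^ n) x = 0) ?_ ?_ ?_ ?_ x
    · exact ⟨1, by simp [dropE1_one]⟩
    · rintro x a ⟨n, hn⟩
      refine ⟨n + 1, ?_⟩
      rw [pow_succ, Module.End.mul_apply, dropE1_append]
      split_ifs
      · exact hn
      · exact map_zero _
    · rintro x y ⟨n, hn⟩ ⟨m, hm⟩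
      refine ⟨n + m, ?_⟩
      rw [map_add]
      nth_rw 1 [add_comm n m]
      rw [pow_add, pow_add, Module.End.mul_apply, Module.End.mul_apply, hn, hm]
      simp
    · rintro c x ⟨n, hn⟩
      exact ⟨n, by rw [map_smul, hn, smul_zero]⟩
  have hint : ∀ p : Polynomial H0Star, ∃ q : Polynomial H0Star, q.derivative = p := by
    intro p
    induction p using Polynomial.induction_on' with
    | add p q hp hq =>
      obtain ⟨p', rfl⟩ := hp
      obtain ⟨q', rfl⟩ := hq
      exact ⟨p' + q', Polynomial.derivative_add⟩
    | monomial n c =>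
      refine ⟨Polynomial.monomial (n + 1) (((n + 1 : ℚ)⁻¹) • c), ?_⟩
      rw [Polynomial.derivative_monomial]
      have hn : (n + 1 : ℚ) ≠ 0 := by positivity
      have : ((n + 1 : ℕ) : H0Star) = algebraMap ℚ H0Star (n + 1 : ℚ) := by
        rw [map_add, map_natCast, map_one, Nat.cast_add, Nat.cast_one]
      rw [Nat.add_sub_cancel, this, mul_comm, ← Algebra.smul_def, smul_smul,
        mul_inv_cancel₀ hn, one_smul]
  have main : ∀ (n : ℕ) (x : H1), (dropE1 ^ n) x = 0 → ∃ p, fromPoly p = toStar x := by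
    intro n
    induction n with
    | zero => exact fun x hx => ⟨0, by rw [map_zero, show x = 0 from hx, map_zero]⟩
    | succ n ih =>
      intro x hx
      rw [pow_succ, Module.End.mul_apply] at hx
      obtain ⟨p, hp⟩ := ih _ hx
      obtain ⟨q, rfl⟩ := hint p
      have h0 : derivE1 (toStar x - fromPoly q) = 0 := by
        rw [map_sub, derivE1_fromPoly, hp]
        exact sub_self (toStar (dropE1 x))
      have h1 : toStar x - fromPoly q ∈ H0Star :=
        mem_H0_of_dropE1 (x := toStar.symm (toStar x - fromPoly q)) h0
      refine ⟨Polynomial.C ⟨_, h1⟩ + q, ?_⟩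
      rw [map_add, fromPoly_C, sub_add_cancel]
  intro x
  obtain ⟨n, hn⟩ := hnil (toStar.symm x)
  exact main n _ hn

/-- The isomorphism `𝔥⁰_*[T] ≃ 𝔥¹_*` which is the identity on `𝔥⁰_*` and sends `T` to `e₁`. -/
def polyEquiv : Polynomial H0Star ≃ₐ[H0Star] H1Star :=
  AlgEquiv.ofBijective fromPoly ⟨fromPoly_injective, fromPoly_surjective⟩

/-- The regularization `reg_* : 𝔥¹_* → 𝔥⁰_*`: the isomorphism `𝔥¹_* ≃ 𝔥⁰_*[T]` followed by the
specialization `T ↦ 0`. -/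
def regStar : H1Star →ₐ[H0Star] H0Star :=
  (Polynomial.aeval (0 : H0Star)).comp polyEquiv.symm.toAlgHom

/-- The multiple zeta value `ζ(k₁, …, k_r) = ∑_{0 < n₁ < ⋯ < n_r} ∏ᵢ nᵢ^{-kᵢ}`. -/
def zeta (k : List ℕ+) : ℝ :=
  ∑' n : {n : Fin k.length → ℕ // StrictMono n ∧ ∀ i, 0 < n i},
    ∏ i, 1 / (n.1 i : ℝ) ^ (k.get i : ℕ)

/-- The `ℚ`-linear map `Z : 𝔥⁰ → ℝ` with `Z(e_k) = ζ(k)` for every admissible index `k`; recall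
that the `e_k` with `k` admissible form a basis of `𝔥⁰`. -/
def Z : H0Star →ₗ[ℚ] ℝ :=
  basisH1.constr ℚ zeta ∘ₗ toStar.symm.toLinearMap ∘ₗ H0Star.val.toLinearMap

theorem Z_eIdx (k : List ℕ+) (hk : Admissible k) :
    Z ⟨toStar ⟨eIdx k, eIdx_mem_H1 k⟩, eIdx_mem_H0 hk⟩ = zeta k := by
  have : (⟨eIdx k, eIdx_mem_H1 k⟩ : H1) = basisH1 k := Subtype.ext (coe_basisH1 k).symm
  simp [Z, this]

theorem Z_one : Z 1 = 1 := by
  have h := Z_eIdx [] (by simp [Admissible])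
  have h1 : zeta [] = 1 := by
    have : Unique {n : Fin ([] : List ℕ+).length → ℕ // StrictMono n ∧ ∀ i, 0 < n i} :=
      { default := ⟨Fin.elim0, fun i => i.elim0, fun i => i.elim0⟩
        uniq := fun n => Subtype.ext (funext fun i => i.elim0) }
    rw [zeta, tsum_fintype]
    simp
  rw [← h1, ← h]
  rfl

end MZV

end

/-!
The relation is obtained as the limit of relations between finite sums, without integrals.

For `M : ℕ` truncate every multiple zeta value to the multiple harmonic sum `mhs` over
`0 < n₁ < ⋯ < n_r ≤ M`. The truncated values form an algebra homomorphism `evalStar M` from `𝔥¹_*`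
to `ℝ` (`evalH_harm`), sending `e₁` to the harmonic number `hn M`.

On the other hand, the multiple harmonic sum of `e_k` equals a discretized iterated integral `flat`
of the word `e_k`, in which `dt / (1 - t)` and `dt / t` are replaced by the weights
`1 / (M + 1 - n)` and `1 / n` on `0 < n ≤ M` (`mhs_eq_flat`, proved by transporting letters through
the connector `binom(m, n) / binom(M, n)`). Discretized iterated integrals satisfy the shuffle
relation up to the terms in which two summation variables coincide. Such a term carries the square
of a weight, and if one of the two words ends with `e₀`, then the total error is
`O((log M)^K / M)` (`abs_shDefect_zero_le`).

Hence `evalStar M (w₁ * w₀ - w₁ sh w₀)` tends to `0`. Write this element as a polynomial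
`∑ c_j e₁^j` with `c_j ∈ 𝔥⁰_*`. As `evalStar M c_j` converges to `Z c_j` faster than any power of
`hn M` grows (`tendsto_mhs_sub_zeta_mul`), the real polynomial `∑ Z(c_j) T^j` tends to `0` along
`T = hn M → ∞`. It is therefore zero, and its constant term is the value of `Z ∘ reg_*`
(`Z_regStar_eq_zero`).
-/

noncomputable section

namespace MZV

open Filter Topology

/-! ### Multiple harmonic sums -/

/-- The multiple harmonic sum `∑_{0 < n₁ < ⋯ < n_r ≤ M} ∏ᵢ nᵢ^{-kᵢ}`; the index is given by its
list of entries read from right to left, and the outermost summation variable is `i + 1`. -/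
def mhs : List ℕ+ → ℕ → ℝ
  | [], _ => 1
  | a :: k, M => ∑ i ∈ Finset.range M, mhs k i / ((i : ℝ) + 1) ^ (a : ℕ)

theorem mhs_nonneg (k : List ℕ+) (M : ℕ) : 0 ≤ mhs k M := by
  induction k generalizing M with
  | nil => simp [mhs]
  | cons a k ih =>
    exact Finset.sum_nonneg fun i _ => div_nonneg (ih i) (by positivity)

/-- The harmonic number `∑_{0 < n ≤ M} 1 / n`. -/
def hn (M : ℕ) : ℝ := ∑ i ∈ Finset.range M, 1 / ((i : ℝ) + 1)

theorem mhs_one (M : ℕ) : mhs [1] M = hn M := by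
  simp [mhs, hn]

theorem hn_nonneg (M : ℕ) : 0 ≤ hn M :=
  Finset.sum_nonneg fun i _ => by positivity

theorem hn_mono : Monotone hn := fun a b h =>
  Finset.sum_le_sum_of_subset_of_nonneg (Finset.range_mono h) fun i _ _ => by positivity

theorem mhs_le_hn_pow (k : List ℕ+) (M : ℕ) : mhs k M ≤ hn M ^ k.length := by
  induction k generalizing M with
  | nil => simp [mhs]
  | cons a k ih =>
    rw [mhs, List.length_cons, pow_succ]
    nth_rw 2 [hn]
    rw [Finset.mul_sum]
    refine Finset.sum_le_sum fun i hi => ?_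
    rw [mul_one_div]
    have h1 : hn i ≤ hn M := hn_mono (Finset.mem_range.1 hi).le
    have h2 : ((i : ℝ) + 1) ≤ ((i : ℝ) + 1) ^ (a : ℕ) :=
      le_self_pow₀ (by linarith [i.cast_nonneg (α := ℝ)]) a.ne_zero
    have := pow_nonneg (hn_nonneg M) k.length
    gcongr
    exact (ih i).trans (pow_le_pow_left₀ (hn_nonneg i) h1 _)

/-- The linear map `𝔥¹ → ℝ` sending `e_k` to the multiple harmonic sum of index `k` up to `M`. -/
def evalH (M : ℕ) : H1 →ₗ[ℚ] ℝ := basisH1.constr ℚ fun k => mhs k.reverse M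

theorem evalH_basis (M : ℕ) (k : List ℕ+) : evalH M (basisH1 k) = mhs k.reverse M :=
  Module.Basis.constr_basis _ _ _ _

theorem evalH_one (M : ℕ) : evalH M oneH1 = 1 := by
  rw [← basisH1_nil, evalH_basis]
  rfl

theorem evalH_appendE (M : ℕ) (a : ℕ+) (x : H1) :
    evalH M (appendE a x) =
      ∑ i ∈ Finset.range M, evalH i x / ((i : ℝ) + 1) ^ (a : ℕ) := by
  refine H1_induction (p := fun x => evalH M (appendE a x) =
    ∑ i ∈ Finset.range M, evalH i x / ((i : ℝ) + 1) ^ (a : ℕ)) ?_ ?_ ?_ ?_ x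
  · rw [← basisH1_nil, appendE_basis]
    simp [evalH_basis, mhs]
  · intro x b hx
    clear hx
    have h : (evalH M ∘ₗ appendE a) =
        ∑ i ∈ Finset.range M, ((((i : ℝ) + 1) ^ (a : ℕ))⁻¹) • evalH i := by
      refine basisH1.ext fun k => ?_
      simp [appendE_basis, evalH_basis, mhs, div_eq_inv_mul]
    have := LinearMap.congr_fun h (appendE b x)
    simpa [div_eq_inv_mul] using this
  · intro x y hx hy
    simp only [map_add, hx, hy, add_div, Finset.sum_add_distrib]
  · intro c x hx
    simp only [map_smul, hx, Finset.smul_sum, smul_div_assoc]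

theorem evalH_harm (M : ℕ) (x y : H1) : evalH M (harm x y) = evalH M x * evalH M y := by
  refine H1_induction (p := fun x => ∀ y M, evalH M (harm x y) = evalH M x * evalH M y)
    ?_ ?_ ?_ ?_ x y M
  · intro y M
    rw [one_harm, evalH_one, one_mul]
  · intro x a hx y
    refine H1_induction (p := fun y => ∀ M, evalH M (harm (appendE a x) y) =
      evalH M (appendE a x) * evalH M y) ?_ ?_ ?_ ?_ y
    · intro M
      rw [harm_one, evalH_one, mul_one]
    · intro y b hy M
      rw [harm_append_append]
      simp only [map_add, evalH_appendE _ _ (harm _ _), hx, hy]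
      simp only [← Finset.sum_add_distrib]
      induction M with
      | zero => simp [evalH_appendE]
      | succ M ih =>
        rw [Finset.sum_range_succ, ih]
        simp only [evalH_appendE, Finset.sum_range_succ, PNat.add_coe, pow_add]
        field_simp
        ring
    · intro y z h1 h2 M
      simp only [map_add, h1, h2, mul_add]
    · intro c y h M
      simp only [map_smul, h, mul_smul_comm]
  · intro x z h1 h2 y M
    simp only [map_add, LinearMap.add_apply, h1, h2, add_mul]
  · intro c x h y M
    simp only [map_smul, LinearMap.smul_apply, h, smul_mul_assoc]

/-- `evalH M` as a homomorphism of algebras on `𝔥¹_*`. -/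
def evalStar (M : ℕ) : H1Star →ₐ[ℚ] ℝ :=
  AlgHom.ofLinearMap (evalH M ∘ₗ toStar.symm.toLinearMap) (evalH_one M)
    fun x y => evalH_harm M x y

theorem evalStar_e1 (M : ℕ) : evalStar M e1Star = hn M := by
  rw [e1Star_eq, ← basisH1_nil, appendE_basis, ← mhs_one]
  exact evalH_basis M [1]

/-! ### Discretized iterated integrals -/

/-- The discretized iterated integral up to `m` attached to a word, whose letters are read from
right to left. The letter `e₀` sums against `1 / n` over `n ≤ m`, the letter `e₁` against
`1 / (M + 1 - n)`, where the summation variable of the preceding letter is bounded by `n`,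
respectively by `n - 1`; in both cases `n = i + 1`. -/
def flat (M : ℕ) : List (Fin 2) → ℕ → ℝ
  | [], _ => 1
  | 0 :: u, m => ∑ i ∈ Finset.range m, flat M u (i + 1) / ((i : ℝ) + 1)
  | 1 :: u, m => ∑ i ∈ Finset.range m, flat M u i / ((M : ℝ) - i)

/-- The word, read from right to left, is empty or begins with `e₁`. -/
def StartsE1 (u : List (Fin 2)) : Prop := ∀ a ∈ u.getLast?, a = 1

theorem StartsE1.tail {a : Fin 2} {u : List (Fin 2)} (h : StartsE1 (a :: u)) : StartsE1 u := by
  intro b hb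
  apply h
  cases u with
  | nil => simp at hb
  | cons c w => simpa using hb

theorem StartsE1.ne_nil {u : List (Fin 2)} (h : StartsE1 (0 :: u)) : u ≠ [] := by
  rintro rfl
  have := h 0 (by simp)
  simp at this

/-- The summand of the multiple harmonic sum of a word with largest summation variable `n`; the
letters are read from right to left. On the word `e_k` it is
`∑_{0 < n₁ < ⋯ < n_r = n} ∏ᵢ nᵢ^{-kᵢ}`. -/
def layer : List (Fin 2) → ℕ → ℝ
  | [], n => if n = 0 then 1 else 0
  | 0 :: u, n => layer u n / n
  | 1 :: u, n => (∑ j ∈ Finset.range n, layer u j) / n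

theorem layer_zero {u : List (Fin 2)} (hu : u ≠ []) : layer u 0 = 0 := by
  match u with
  | [] => exact absurd rfl hu
  | 0 :: u => simp [layer]
  | 1 :: u => simp [layer]

/-- The connector `binom(m, n) / binom(M, n)` linking `layer` to `flat`. -/
def conn (M n m : ℕ) : ℝ := (m.choose n : ℝ) / (M.choose n : ℝ)

/-- The transport relation carrying the letter `e₀` across the connector. -/
theorem conn_transport_zero (M n m : ℕ) :
    (conn M (n + 1) (m + 1) - conn M (n + 1) m) / ((n : ℝ) + 1) =
      conn M (n + 1) (m + 1) / ((m : ℝ) + 1) := by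
  have h1 := Nat.choose_succ_succ' m n
  have h2 := Nat.add_one_mul_choose_eq m n
  have h1' : ((m + 1).choose (n + 1) : ℝ) = m.choose n + m.choose (n + 1) := by exact_mod_cast h1
  have h2' : ((m : ℝ) + 1) * m.choose n = (m + 1).choose (n + 1) * ((n : ℝ) + 1) := by
    exact_mod_cast h2
  have hn : (n : ℝ) + 1 ≠ 0 := by positivity
  have hm : (m : ℝ) + 1 ≠ 0 := by positivity
  rw [conn, conn, ← sub_div, div_right_comm, div_right_comm _ _ ((m : ℝ) + 1)]
  congr 1
  rw [div_eq_div_iff hn hm]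
  linear_combination h2' + (m + 1) * h1'

/-- The transport relation carrying the letter `e₁` across the connector. -/
theorem conn_transport_one {M n m : ℕ} (hn : n < M) (hm : m < M) :
    (conn M (n + 1) (m + 1) - conn M (n + 1) m) / ((n : ℝ) + 1) =
      (conn M n m - conn M (n + 1) m) / ((M : ℝ) - m) := by
  have h1' : ((m + 1).choose (n + 1) : ℝ) = m.choose n + m.choose (n + 1) := by
    exact_mod_cast Nat.choose_succ_succ' m n
  have h2 : ∀ m : ℕ, (m.choose (n + 1) : ℝ) * ((n : ℝ) + 1) = m.choose n * ((m : ℝ) - n) := by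
    intro m
    rcases lt_or_ge m n with h | h
    · simp [Nat.choose_eq_zero_of_lt h, Nat.choose_eq_zero_of_lt (h.trans (Nat.lt_succ_self n))]
    · have := Nat.choose_succ_right_eq m n
      rw [← Nat.cast_sub h]
      exact_mod_cast this
  have hn0 : (n : ℝ) + 1 ≠ 0 := by positivity
  have hM : (M : ℝ) - m ≠ 0 := sub_ne_zero.2 (by exact_mod_cast hm.ne')
  have hMn : (M : ℝ) - n ≠ 0 := sub_ne_zero.2 (by exact_mod_cast hn.ne')
  have hB : (M.choose n : ℝ) ≠ 0 := by exact_mod_cast (Nat.choose_pos hn.le).ne'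
  have hB' : (M.choose (n + 1) : ℝ) = M.choose n * ((M : ℝ) - n) / ((n : ℝ) + 1) := by
    rw [eq_div_iff hn0, h2 M]
  have hm' : (m.choose (n + 1) : ℝ) = m.choose n * ((m : ℝ) - n) / ((n : ℝ) + 1) := by
    rw [eq_div_iff hn0, h2 m]
  rw [conn, conn, conn, h1', hB', hm']
  field_simp
  ring

theorem sum_by_parts (a c : ℕ → ℝ) (K : ℕ) :
    ∑ n ∈ Finset.range K, (∑ j ∈ Finset.range (n + 1), a j) * (c n - c (n + 1)) =
      ∑ j ∈ Finset.range K, a j * c j - (∑ j ∈ Finset.range K, a j) * c K := by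
  induction K with
  | zero => simp
  | succ K ih =>
    rw [Finset.sum_range_succ, ih]
    simp only [Finset.sum_range_succ]
    ring

/-- The discretized iterated integral is the binomial transform of the layers of the multiple
harmonic sum; appending a letter is carried from one side to the other by the two transport
relations of the connector. -/
theorem flat_eq_sum_layer (M : ℕ) {u : List (Fin 2)} (hu : StartsE1 u) {m : ℕ} (hm : m ≤ M) :
    flat M u m = ∑ n ∈ Finset.range (M + 1), layer u n * conn M n m := by
  match u with
  | [] => simp [flat, layer, conn]
  | 0 :: u =>
    have ih := fun m hm => flat_eq_sum_layer M (m := m) hu.tail hm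
    have hl := layer_zero hu.ne_nil
    induction m with
    | zero =>
      rw [flat, Finset.sum_range_succ']
      simp [layer, conn]
    | succ m ihm =>
      have := ihm (by omega)
      rw [flat] at this ⊢
      rw [Finset.sum_range_succ, this, ih _ hm, ← eq_sub_iff_add_eq', ← Finset.sum_sub_distrib,
        Finset.sum_div, Finset.sum_range_succ', Finset.sum_range_succ' _ M]
      congr 1
      · refine Finset.sum_congr rfl fun n _ => ?_
        have := conn_transport_zero M n m
        rw [layer, mul_div_assoc, ← this]
        push_cast
        ring
      · simp [layer, hl]
  | 1 :: u =>
    have ih := fun m hm => flat_eq_sum_layer M (m := m) hu.tail hm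
    induction m with
    | zero =>
      rw [flat, Finset.sum_range_succ']
      simp [layer, conn]
    | succ m ihm =>
      have := ihm (by omega)
      rw [flat] at this ⊢
      have hM : conn M M m = 0 := by simp [conn, Nat.choose_eq_zero_of_lt hm]
      have key := sum_by_parts (layer u) (fun n => conn M n m) M
      rw [hM, mul_zero, sub_zero] at key
      rw [Finset.sum_range_succ, this, ih _ (by omega), ← eq_sub_iff_add_eq',
        ← Finset.sum_sub_distrib, Finset.sum_range_succ _ M, hM, mul_zero, add_zero, ← key,
        Finset.sum_div, Finset.sum_range_succ']
      simp only [layer, Finset.range_zero, Finset.sum_empty, zero_div, zero_mul, sub_zero,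
        add_zero]
      refine Finset.sum_congr rfl fun n hn => ?_
      rw [mul_div_assoc, ← conn_transport_one (Finset.mem_range.1 hn) hm]
      push_cast
      ring

theorem layer_replicate (c n : ℕ) (u : List (Fin 2)) :
    layer (List.replicate c 0 ++ u) n = layer u n / (n : ℝ) ^ c := by
  induction c with
  | zero => simp
  | succ c ih =>
    rw [List.replicate_succ, List.cons_append, layer, ih, pow_succ, div_div]

theorem idxLetters_concat_reverse (k : List ℕ+) (a : ℕ+) :
    (idxLetters (k ++ [a])).reverse =
      List.replicate ((a : ℕ) - 1) 0 ++ 1 :: (idxLetters k).reverse := by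
  simp [idxLetters]

theorem startsE1_idxLetters (k : List ℕ+) : StartsE1 (idxLetters k).reverse := by
  unfold StartsE1
  cases k <;> simp [idxLetters]

theorem sum_layer_idxLetters (k : List ℕ+) (M : ℕ) :
    ∑ n ∈ Finset.range (M + 1), layer (idxLetters k).reverse n = mhs k.reverse M := by
  induction k using List.reverseRecOn generalizing M with
  | nil => simp [idxLetters, layer, mhs]
  | append_singleton k a ih =>
    rw [idxLetters_concat_reverse, List.reverse_append, Finset.sum_range_succ']
    simp only [layer_replicate, layer, ih, List.reverse_singleton, List.singleton_append, mhs]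
    simp only [Finset.range_zero, Finset.sum_empty, Nat.cast_zero, zero_div, add_zero]
    refine Finset.sum_congr rfl fun i _ => ?_
    rw [div_div, ← pow_succ', Nat.sub_add_cancel a.pos]
    push_cast
    rfl

/-- A multiple harmonic sum equals the discretized iterated integral of its word. -/
theorem mhs_eq_flat (k : List ℕ+) (M : ℕ) :
    mhs k.reverse M = flat M (idxLetters k).reverse M := by
  rw [flat_eq_sum_layer M (startsE1_idxLetters k) le_rfl, ← sum_layer_idxLetters]
  refine Finset.sum_congr rfl fun n hn => ?_
  have : (M.choose n : ℝ) ≠ 0 := by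
    exact_mod_cast (Nat.choose_pos (Nat.lt_succ_iff.1 (Finset.mem_range.1 hn))).ne'
  rw [conn, div_self this, mul_one]

/-! ### The shuffle product of discretized iterated integrals -/

/-- The linear map `ℚ⟨e₀, e₁⟩ → ℝ` sending a word to its discretized iterated integral. -/
def flatLin (M m : ℕ) : Hoff →ₗ[ℚ] ℝ := wordBasis.constr ℚ fun u => flat M u.reverse m

theorem flatLin_word (M m : ℕ) (u : List (Fin 2)) :
    flatLin M m (word u) = flat M u.reverse m := by
  rw [← wordBasis_apply]
  exact Module.Basis.constr_basis _ _ _ _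

theorem flatLin_mul_e0 (M m : ℕ) (x : Hoff) :
    flatLin M m (x * e 0) =
      ∑ i ∈ Finset.range m, flatLin M (i + 1) x / ((i : ℝ) + 1) := by
  have h : flatLin M m ∘ₗ LinearMap.mulRight ℚ (e 0) =
      ∑ i ∈ Finset.range m, (((i : ℝ) + 1)⁻¹) • flatLin M (i + 1) := by
    refine wordBasis.ext fun u => ?_
    simp [wordBasis_apply, ← word_concat, flatLin_word, flat, div_eq_inv_mul]
  simpa [div_eq_inv_mul] using LinearMap.congr_fun h x

theorem flatLin_mul_e1 (M m : ℕ) (x : Hoff) :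
    flatLin M m (x * e 1) =
      ∑ i ∈ Finset.range m, flatLin M i x / ((M : ℝ) - i) := by
  have h : flatLin M m ∘ₗ LinearMap.mulRight ℚ (e 1) =
      ∑ i ∈ Finset.range m, (((M : ℝ) - i)⁻¹) • flatLin M i := by
    refine wordBasis.ext fun u => ?_
    simp [wordBasis_apply, ← word_concat, flatLin_word, flat, div_eq_inv_mul]
  simpa [div_eq_inv_mul] using LinearMap.congr_fun h x

/-- The defect of the shuffle relation for discretized iterated integrals; the words are read from
right to left. -/
def shDefect (M : ℕ) (u v : List (Fin 2)) (m : ℕ) : ℝ :=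
  flat M u m * flat M v m - flatLin M m (shRev u v)

theorem shDefect_nil_left (M : ℕ) (v : List (Fin 2)) (m : ℕ) : shDefect M [] v m = 0 := by
  rw [shDefect, shRev, flatLin_word, List.reverse_reverse, flat, one_mul, sub_self]

theorem shDefect_nil_right (M : ℕ) (u : List (Fin 2)) (m : ℕ) : shDefect M u [] m = 0 := by
  rcases u with _ | ⟨a, u⟩
  · exact shDefect_nil_left M [] m
  · rw [shDefect, shRev, flatLin_word, List.reverse_reverse, flat, mul_one, sub_self]
    simp

/-- The recursion of the shuffle product for two last letters `e₀`. Both summation variables may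
equal `i + 1`; this diagonal is counted twice on the right, so it is subtracted once. -/
theorem shDefect_zero_zero (M : ℕ) (u v : List (Fin 2)) (m : ℕ) :
    shDefect M (0 :: u) (0 :: v) m =
      ∑ i ∈ Finset.range m, shDefect M u (0 :: v) (i + 1) / ((i : ℝ) + 1) +
      ∑ i ∈ Finset.range m, shDefect M (0 :: u) v (i + 1) / ((i : ℝ) + 1) -
      ∑ i ∈ Finset.range m, flat M u (i + 1) * flat M v (i + 1) / ((i : ℝ) + 1) ^ 2 := by
  induction m with
  | zero => simp [shDefect, flat, shRev, flatLin_mul_e0]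
  | succ m ih =>
    simp only [shDefect, shRev, map_add, flatLin_mul_e0, Finset.sum_range_succ] at ih ⊢
    simp only [flat, Finset.sum_range_succ] at ih ⊢
    field_simp at ih ⊢
    linear_combination ((m : ℝ) + 1) ^ 2 * ih

/-- The recursion of the shuffle product for two last letters `e₁`. The bounds being strict, the
diagonal is missing from the first two sums, so it is added. -/
theorem shDefect_one_one {M : ℕ} (u v : List (Fin 2)) {m : ℕ} :
    shDefect M (1 :: u) (1 :: v) m =
      ∑ i ∈ Finset.range m, shDefect M u (1 :: v) i / ((M : ℝ) - i) +
      ∑ i ∈ Finset.range m, shDefect M (1 :: u) v i / ((M : ℝ) - i) +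
      ∑ i ∈ Finset.range m, flat M u i * flat M v i / ((M : ℝ) - i) ^ 2 := by
  induction m with
  | zero => simp [shDefect, flat, shRev, flatLin_mul_e1]
  | succ m ih =>
    simp only [shDefect, shRev, map_add, flatLin_mul_e1, Finset.sum_range_succ] at ih ⊢
    simp only [flat, Finset.sum_range_succ] at ih ⊢
    generalize (M : ℝ) - m = q
    linear_combination ih

/-- For different last letters there is no diagonal term: coinciding summation variables are
counted exactly once, with `e₁` before `e₀`. -/
theorem shDefect_one_zero {M : ℕ} (u v : List (Fin 2)) {m : ℕ} :
    shDefect M (1 :: u) (0 :: v) m =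
      ∑ i ∈ Finset.range m, shDefect M u (0 :: v) i / ((M : ℝ) - i) +
      ∑ i ∈ Finset.range m, shDefect M (1 :: u) v (i + 1) / ((i : ℝ) + 1) := by
  induction m with
  | zero => simp [shDefect, flat, shRev, flatLin_mul_e1, flatLin_mul_e0]
  | succ m ih =>
    simp only [shDefect, shRev, map_add, flatLin_mul_e1, flatLin_mul_e0,
      Finset.sum_range_succ] at ih ⊢
    simp only [flat, Finset.sum_range_succ] at ih ⊢
    linear_combination ih

theorem shDefect_zero_one {M : ℕ} (u v : List (Fin 2)) {m : ℕ} :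
    shDefect M (0 :: u) (1 :: v) m =
      ∑ i ∈ Finset.range m, shDefect M u (1 :: v) (i + 1) / ((i : ℝ) + 1) +
      ∑ i ∈ Finset.range m, shDefect M (0 :: u) v i / ((M : ℝ) - i) := by
  induction m with
  | zero => simp [shDefect, flat, shRev, flatLin_mul_e1, flatLin_mul_e0]
  | succ m ih =>
    simp only [shDefect, shRev, map_add, flatLin_mul_e1, flatLin_mul_e0,
      Finset.sum_range_succ] at ih ⊢
    simp only [flat, Finset.sum_range_succ] at ih ⊢
    linear_combination ih

/-! ### Bounds for discretized iterated integrals and for the shuffle defect -/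

theorem sub_cast_pos {M m i : ℕ} (hm : m ≤ M) (hi : i ∈ Finset.range m) : 0 < (M : ℝ) - i :=
  sub_pos.2 (by exact_mod_cast (Finset.mem_range.1 hi).trans_le hm)

theorem sum_inv_sub_le {M m : ℕ} (hm : m ≤ M) :
    ∑ i ∈ Finset.range m, 1 / ((M : ℝ) - i) ≤ hn M := by
  have h1 : ∑ i ∈ Finset.range M, 1 / ((M : ℝ) - i) = hn M := by
    rw [hn, ← Finset.sum_range_reflect]
    refine Finset.sum_congr rfl fun i hi => ?_
    have hi := Finset.mem_range.1 hi
    rw [Nat.sub_sub, Nat.cast_sub (by omega)]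
    push_cast
    congr 1
    ring
  rw [← h1]
  refine Finset.sum_le_sum_of_subset_of_nonneg (Finset.range_mono hm) fun i hi _ => ?_
  have := sub_cast_pos le_rfl hi
  positivity

theorem abs_sum_div_succ_le {M m : ℕ} (hm : m ≤ M) {a : ℕ → ℝ} {c : ℝ} (hc : 0 ≤ c)
    (ha : ∀ i < m, |a i| ≤ c) : |∑ i ∈ Finset.range m, a i / ((i : ℝ) + 1)| ≤ c * hn M := by
  calc |∑ i ∈ Finset.range m, a i / ((i : ℝ) + 1)|
      ≤ ∑ i ∈ Finset.range m, |a i / ((i : ℝ) + 1)| := Finset.abs_sum_le_sum_abs _ _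
    _ ≤ ∑ i ∈ Finset.range m, c * (1 / ((i : ℝ) + 1)) := by
      refine Finset.sum_le_sum fun i hi => ?_
      have h : (0 : ℝ) < (i : ℝ) + 1 := by positivity
      rw [abs_div, abs_of_pos h, mul_one_div]
      gcongr
      exact ha i (Finset.mem_range.1 hi)
    _ = c * hn m := by rw [← Finset.mul_sum, hn]
    _ ≤ c * hn M := by gcongr; exact hn_mono hm

theorem abs_sum_div_sub_le {M m : ℕ} (hm : m ≤ M) {a : ℕ → ℝ} {c : ℝ} (hc : 0 ≤ c)
    (ha : ∀ i < m, |a i| ≤ c) : |∑ i ∈ Finset.range m, a i / ((M : ℝ) - i)| ≤ c * hn M := by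
  calc |∑ i ∈ Finset.range m, a i / ((M : ℝ) - i)|
      ≤ ∑ i ∈ Finset.range m, |a i / ((M : ℝ) - i)| := Finset.abs_sum_le_sum_abs _ _
    _ ≤ ∑ i ∈ Finset.range m, c * (1 / ((M : ℝ) - i)) := by
      refine Finset.sum_le_sum fun i hi => ?_
      have h := sub_cast_pos hm hi
      rw [abs_div, abs_of_pos h, mul_one_div]
      gcongr
      exact ha i (Finset.mem_range.1 hi)
    _ ≤ c * hn M := by
      rw [← Finset.mul_sum]
      gcongr
      exact sum_inv_sub_le hm

theorem flat_nonneg {M : ℕ} (u : List (Fin 2)) {m : ℕ} (hm : m ≤ M) : 0 ≤ flat M u m := by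
  match u with
  | [] => simp [flat]
  | 0 :: u =>
    refine Finset.sum_nonneg fun i hi => div_nonneg (flat_nonneg u ?_) (by positivity)
    have := Finset.mem_range.1 hi
    omega
  | 1 :: u =>
    refine Finset.sum_nonneg fun i hi => div_nonneg (flat_nonneg u ?_) (sub_cast_pos hm hi).le
    have := Finset.mem_range.1 hi
    omega

/-- The discretized iterated integral of a nonempty word beginning with `e₁` is small for small
upper bounds `m`. -/
theorem flat_le_of_ne_nil {M : ℕ} {u : List (Fin 2)} (hu : StartsE1 u) (hne : u ≠ []) {m : ℕ}
    (hm : m ≤ M) : flat M u m ≤ m / ((M : ℝ) + 1) * (1 + hn M) ^ u.length := by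
  have hh := hn_nonneg M
  match u with
  | 0 :: u =>
    have ih := fun m hm => flat_le_of_ne_nil (M := M) hu.tail hu.ne_nil (m := m) hm
    have hp : (1 + hn M) ^ u.length ≤ (1 + hn M) ^ (0 :: u).length :=
      pow_le_pow_right₀ (by linarith) (by simp)
    calc flat M (0 :: u) m ≤ ∑ i ∈ Finset.range m, 1 / ((M : ℝ) + 1) * (1 + hn M) ^ u.length := by
          refine Finset.sum_le_sum fun i hi => ?_
          have := ih (i + 1) (by have := Finset.mem_range.1 hi; omega)
          rw [div_le_iff₀ (by positivity)]
          refine this.trans_eq ?_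
          push_cast
          ring
      _ = m / ((M : ℝ) + 1) * (1 + hn M) ^ u.length := by
          rw [Finset.sum_const, Finset.card_range, nsmul_eq_mul]
          ring
      _ ≤ _ := by gcongr
  | [1] =>
    calc flat M [1] m ≤ ∑ i ∈ Finset.range m,
          (1 / ((M : ℝ) + 1) + m / ((M : ℝ) + 1) * (1 / ((M : ℝ) - i))) := by
          refine Finset.sum_le_sum fun i hi => ?_
          have h := sub_cast_pos hm hi
          have hi' : (i : ℝ) + 1 ≤ m := by exact_mod_cast Finset.mem_range.1 hi
          rw [flat, ← sub_nonneg]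
          have : 1 / ((M : ℝ) + 1) + m / ((M : ℝ) + 1) * (1 / ((M : ℝ) - i)) - 1 / ((M : ℝ) - i)
              = (m - ((i : ℝ) + 1)) / (((M : ℝ) + 1) * ((M : ℝ) - i)) := by
            field_simp
            ring
          rw [this]
          exact div_nonneg (by linarith) (by positivity)
      _ = m / ((M : ℝ) + 1) + m / ((M : ℝ) + 1) * ∑ i ∈ Finset.range m, 1 / ((M : ℝ) - i) := by
          rw [Finset.sum_add_distrib, ← Finset.mul_sum, Finset.sum_const, Finset.card_range,
            nsmul_eq_mul, mul_one_div]
      _ ≤ m / ((M : ℝ) + 1) + m / ((M : ℝ) + 1) * hn M := by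
          gcongr
          exact sum_inv_sub_le hm
      _ = _ := by
          simp
          ring
  | 1 :: b :: u =>
    have ih := fun m hm => flat_le_of_ne_nil (M := M) hu.tail (by simp) (m := m) hm
    refine (le_abs_self _).trans ((abs_sum_div_sub_le hm (a := flat M (b :: u))
      (c := m / ((M : ℝ) + 1) * (1 + hn M) ^ (b :: u).length) (by positivity) ?_).trans ?_)
    · intro i hi
      rw [abs_of_nonneg (flat_nonneg _ (by omega))]
      refine (ih i (by omega)).trans ?_
      gcongr
    · rw [List.length_cons (a := 1), pow_succ, ← mul_assoc]
      gcongr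
      linarith

theorem flat_le {M : ℕ} (u : List (Fin 2)) {m : ℕ} (hm : m ≤ M) :
    flat M u m ≤ (1 + hn M) ^ u.length := by
  have hh := hn_nonneg M
  match u with
  | [] => simp [flat]
  | 0 :: u =>
    refine (le_abs_self _).trans ((abs_sum_div_succ_le hm (a := fun i => flat M u (i + 1))
      (c := (1 + hn M) ^ u.length) (by positivity) ?_).trans ?_)
    · intro i hi
      rw [abs_of_nonneg (flat_nonneg _ (by omega))]
      exact flat_le u (by omega)
    · rw [List.length_cons, pow_succ]
      gcongr
      linarith
  | 1 :: u =>
    refine (le_abs_self _).trans ((abs_sum_div_sub_le hm (a := flat M u)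
      (c := (1 + hn M) ^ u.length) (by positivity) ?_).trans ?_)
    · intro i hi
      rw [abs_of_nonneg (flat_nonneg _ (by omega))]
      exact flat_le u (by omega)
    · rw [List.length_cons, pow_succ]
      gcongr
      linarith

theorem sum_inv_sub_sq_le {M m : ℕ} (hm : m ≤ M) :
    ∑ i ∈ Finset.range m, 1 / ((M : ℝ) - i) ^ 2 ≤ 2 / ((M : ℝ) + 1 - m) := by
  induction m with
  | zero => simp; positivity
  | succ m ih =>
    have hq : (1 : ℝ) ≤ (M : ℝ) - m := by
      rw [le_sub_iff_add_le']
      exact_mod_cast hm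
    rw [Finset.sum_range_succ]
    refine (add_le_add_left (ih (by omega)) _).trans ?_
    push_cast
    rw [show (M : ℝ) + 1 - m = ((M : ℝ) - m) + 1 by ring,
      show (M : ℝ) + 1 - ((m : ℝ) + 1) = (M : ℝ) - m by ring]
    generalize (M : ℝ) - m = q at hq
    have : 2 / q - (2 / (q + 1) + 1 / q ^ 2) = (q - 1) / (q ^ 2 * (q + 1)) := by
      field_simp
      ring
    have h2 : 0 ≤ (q - 1) / (q ^ 2 * (q + 1)) := div_nonneg (by linarith) (by positivity)
    linarith

/-- Coinciding letters `e₀` contribute a negligible error. -/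
theorem sum_flat_mul_flat_div_succ_sq_le {M : ℕ} {u v : List (Fin 2)} (hu : StartsE1 (0 :: u))
    (hv : StartsE1 (0 :: v)) {m : ℕ} (hm : m ≤ M) :
    |∑ i ∈ Finset.range m, flat M u (i + 1) * flat M v (i + 1) / ((i : ℝ) + 1) ^ 2| ≤
      (1 + hn M) ^ (u.length + v.length) / ((M : ℝ) + 1) := by
  have hh := hn_nonneg M
  have hi' : ∀ i ∈ Finset.range m, i + 1 ≤ M := fun i hi => by
    have := Finset.mem_range.1 hi
    omega
  rw [abs_of_nonneg (Finset.sum_nonneg fun i hi => div_nonneg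
    (mul_nonneg (flat_nonneg _ (hi' i hi)) (flat_nonneg _ (hi' i hi))) (by positivity))]
  calc ∑ i ∈ Finset.range m, flat M u (i + 1) * flat M v (i + 1) / ((i : ℝ) + 1) ^ 2
      ≤ ∑ i ∈ Finset.range m, (1 + hn M) ^ (u.length + v.length) / ((M : ℝ) + 1) ^ 2 := by
        refine Finset.sum_le_sum fun i hi => ?_
        rw [div_le_iff₀ (by positivity)]
        refine (mul_le_mul (flat_le_of_ne_nil hu.tail hu.ne_nil (hi' i hi))
          (flat_le_of_ne_nil hv.tail hv.ne_nil (hi' i hi)) (flat_nonneg _ (hi' i hi))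
          (by positivity)).trans_eq ?_
        generalize (M : ℝ) + 1 = q
        push_cast
        ring
    _ = (m / ((M : ℝ) + 1)) * ((1 + hn M) ^ (u.length + v.length) / ((M : ℝ) + 1)) := by
        rw [Finset.sum_const, Finset.card_range, nsmul_eq_mul]
        field_simp
    _ ≤ 1 * ((1 + hn M) ^ (u.length + v.length) / ((M : ℝ) + 1)) := by
        gcongr
        rw [div_le_one (by positivity)]
        have : (m : ℝ) ≤ M := by exact_mod_cast hm
        linarith
    _ = _ := one_mul _

/-- The error contributed by coinciding letters `e₁`. -/
theorem sum_flat_mul_flat_div_sub_sq_le {M : ℕ} (u v : List (Fin 2)) {m : ℕ} (hm : m ≤ M) :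
    |∑ i ∈ Finset.range m, flat M u i * flat M v i / ((M : ℝ) - i) ^ 2| ≤
      (1 + hn M) ^ (u.length + v.length) * (2 / ((M : ℝ) + 1 - m)) := by
  have hh := hn_nonneg M
  have hi' : ∀ i ∈ Finset.range m, i ≤ M := fun i hi => by
    have := Finset.mem_range.1 hi
    omega
  rw [abs_of_nonneg (Finset.sum_nonneg fun i hi => div_nonneg
    (mul_nonneg (flat_nonneg _ (hi' i hi)) (flat_nonneg _ (hi' i hi))) (by positivity))]
  calc ∑ i ∈ Finset.range m, flat M u i * flat M v i / ((M : ℝ) - i) ^ 2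
      ≤ ∑ i ∈ Finset.range m, (1 + hn M) ^ (u.length + v.length) * (1 / ((M : ℝ) - i) ^ 2) := by
        refine Finset.sum_le_sum fun i hi => ?_
        rw [mul_one_div, pow_add]
        gcongr
        · exact flat_nonneg _ (hi' i hi)
        · exact flat_le _ (hi' i hi)
        · exact flat_le _ (hi' i hi)
    _ ≤ _ := by
        rw [← Finset.mul_sum]
        gcongr
        exact sum_inv_sub_sq_le hm

/-- A bound for the shuffle defect which blows up at most like `1 / (M + 1 - m)`, whatever the
last letters of the two words are. The factor `4 * (1 + hn M)` per letter absorbs the two recursive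
terms, each at most `hn M` times the previous bound, and the diagonal. -/
theorem abs_shDefect_le {M : ℕ} (u v : List (Fin 2)) (hu : StartsE1 u) (hv : StartsE1 v) {m : ℕ}
    (hm : m ≤ M) :
    |shDefect M u v m| ≤ (4 * (1 + hn M)) ^ (u.length + v.length) / ((M : ℝ) + 1 - m) := by
  have hh := hn_nonneg M
  have pos : ∀ m ≤ M, 0 < (M : ℝ) + 1 - m := fun m hm => by
    have : (m : ℝ) ≤ M := by exact_mod_cast hm
    linarith
  set B := 4 * (1 + hn M) with hB
  have hB1 : 1 ≤ B := by linarith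
  induction u, v using shRev.induct generalizing m with
  | case1 v =>
    rw [shDefect_nil_left, abs_zero]
    have := pos m hm
    positivity
  | case2 u hne =>
    rw [shDefect_nil_right, abs_zero]
    have := pos m hm
    positivity
  | case3 a u b v ih1 ih2 =>
    have hq := pos m hm
    set K := u.length + v.length with hK
    set c := B ^ (K + 1) / ((M : ℝ) + 1 - m) with hc
    have hc0 : 0 ≤ c := by positivity
    have mono : ∀ i ≤ m, B ^ (K + 1) / ((M : ℝ) + 1 - i) ≤ c := fun i hi => by
      have : (i : ℝ) ≤ m := by exact_mod_cast hi
      rw [hc]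
      gcongr
    have hl : ∀ i ≤ m, |shDefect M u (b :: v) i| ≤ c := fun i hi => by
      refine le_trans ?_ (mono i hi)
      have := ih1 hu.tail hv (hi.trans hm)
      rwa [List.length_cons, ← add_assoc] at this
    have hr : ∀ i ≤ m, |shDefect M (a :: u) v i| ≤ c := fun i hi => by
      refine le_trans ?_ (mono i hi)
      have := ih2 hu hv.tail (hi.trans hm)
      rwa [List.length_cons, add_right_comm] at this
    have l0 := abs_sum_div_succ_le hm hc0 fun i hi => hl (i + 1) hi
    have l1 := abs_sum_div_sub_le hm hc0 fun i hi => hl i (Nat.le_of_lt hi)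
    have r0 := abs_sum_div_succ_le hm hc0 fun i hi => hr (i + 1) hi
    have r1 := abs_sum_div_sub_le hm hc0 fun i hi => hr i (Nat.le_of_lt hi)
    have pw : (1 + hn M) ^ K / ((M : ℝ) + 1 - m) ≤ c := by
      rw [hc]
      gcongr
      calc (1 + hn M) ^ K ≤ B ^ K := by gcongr; linarith
        _ ≤ B ^ (K + 1) := pow_le_pow_right₀ hB1 (by omega)
    have fin : B ^ ((a :: u).length + (b :: v).length) / ((M : ℝ) + 1 - m) =
        c * hn M * 4 + c * 4 := by
      rw [hc, show (a :: u).length + (b :: v).length = K + 1 + 1 by simp; omega, pow_succ,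
        hB]
      ring
    have hcn : 0 ≤ c * hn M := by positivity
    rw [fin]
    fin_cases a <;> fin_cases b
    · have er := sum_flat_mul_flat_div_succ_sq_le hu hv hm
      have er2 : (1 + hn M) ^ K / ((M : ℝ) + 1) ≤ (1 + hn M) ^ K / ((M : ℝ) + 1 - m) := by
        gcongr
        linarith [m.cast_nonneg (α := ℝ)]
      refine (congrArg abs (shDefect_zero_zero M u v m)).trans_le ?_
      refine (abs_sub _ _).trans ?_
      refine (add_le_add (abs_add_le _ _) le_rfl).trans ?_
      simp only [Fin.zero_eta] at *
      linarith
    · refine (congrArg abs (shDefect_zero_one u v)).trans_le ?_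
      refine (abs_add_le _ _).trans ?_
      simp only [Fin.zero_eta, Fin.mk_one] at *
      linarith
    · refine (congrArg abs (shDefect_one_zero u v)).trans_le ?_
      refine (abs_add_le _ _).trans ?_
      simp only [Fin.zero_eta, Fin.mk_one] at *
      linarith
    · have er := sum_flat_mul_flat_div_sub_sq_le u v hm
      rw [mul_div_assoc', mul_comm _ (2 : ℝ), mul_div_assoc] at er
      refine (congrArg abs (shDefect_one_one u v)).trans_le ?_
      refine (abs_add_le _ _).trans ?_
      refine (add_le_add (abs_add_le _ _) le_rfl).trans ?_
      simp only [Fin.mk_one] at *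
      linarith

/-- If one of the words ends with `e₀`, the shuffle defect is negligible up to `m = M`: the last
sum turns the bound of `abs_shDefect_le` into a uniform one, by partial fractions. -/
theorem abs_shDefect_zero_le {M : ℕ} (u v : List (Fin 2)) (hu : StartsE1 u)
    (hv : StartsE1 (0 :: v)) {m : ℕ} (hm : m ≤ M) :
    |shDefect M u (0 :: v) m| ≤
      (4 * (1 + hn M)) ^ (u.length + v.length + 1) / ((M : ℝ) + 1) := by
  have hh := hn_nonneg M
  induction u generalizing m with
  | nil =>
    rw [shDefect_nil_left, abs_zero]
    positivity
  | cons a u ih =>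
    set B := 4 * (1 + hn M) with hB
    have hB1 : 1 ≤ B := by linarith
    set K := u.length + v.length with hK
    set c := B ^ (K + 1) / ((M : ℝ) + 1) with hc
    have hc0 : 0 ≤ c := by positivity
    have hl : ∀ i ≤ m, |shDefect M u (0 :: v) i| ≤ c := fun i hi => ih hu.tail (hi.trans hm)
    have l0 := abs_sum_div_succ_le hm hc0 fun i hi => hl (i + 1) hi
    have l1 := abs_sum_div_sub_le hm hc0 fun i hi => hl i (Nat.le_of_lt hi)
    have r : |∑ i ∈ Finset.range m, shDefect M (a :: u) v (i + 1) / ((i : ℝ) + 1)| ≤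
        c * hn M + c * hn M := by
      calc _ ≤ ∑ i ∈ Finset.range m, |shDefect M (a :: u) v (i + 1) / ((i : ℝ) + 1)| :=
            Finset.abs_sum_le_sum_abs _ _
        _ ≤ ∑ i ∈ Finset.range m, (c * (1 / ((i : ℝ) + 1)) + c * (1 / ((M : ℝ) - i))) := by
            refine Finset.sum_le_sum fun i hi => ?_
            have h := sub_cast_pos hm hi
            have h' : (0 : ℝ) < (i : ℝ) + 1 := by positivity
            have := abs_shDefect_le (M := M) (a :: u) v hu hv.tail (m := i + 1)
              (by have := Finset.mem_range.1 hi; omega)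
            rw [List.length_cons, add_right_comm, ← hB, ← hK] at this
            push_cast at this
            rw [show (M : ℝ) + 1 - ((i : ℝ) + 1) = (M : ℝ) - i by ring] at this
            rw [abs_div, abs_of_pos h', div_le_iff₀ h']
            refine this.trans_eq ?_
            rw [hc]
            field_simp
            ring
        _ ≤ _ := by
            rw [Finset.sum_add_distrib, ← Finset.mul_sum, ← Finset.mul_sum]
            gcongr
            · exact hn_mono hm
            · exact sum_inv_sub_le hm
    have pw : (1 + hn M) ^ K / ((M : ℝ) + 1) ≤ c := by
      rw [hc]
      gcongr
      calc (1 + hn M) ^ K ≤ B ^ K := by gcongr; linarith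
        _ ≤ B ^ (K + 1) := pow_le_pow_right₀ hB1 (by omega)
    have fin : B ^ ((a :: u).length + v.length + 1) / ((M : ℝ) + 1) =
        c * hn M * 4 + c * 4 := by
      rw [hc, show (a :: u).length + v.length + 1 = K + 1 + 1 by simp; omega, pow_succ, hB]
      ring
    have hcn : 0 ≤ c * hn M := by positivity
    rw [fin]
    fin_cases a
    · have er := sum_flat_mul_flat_div_succ_sq_le hu hv hm
      refine (congrArg abs (shDefect_zero_zero M u v m)).trans_le ?_
      refine (abs_sub _ _).trans ?_
      refine (add_le_add (abs_add_le _ _) le_rfl).trans ?_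
      simp only [Fin.zero_eta] at *
      linarith
    · refine (congrArg abs (shDefect_one_zero u v)).trans_le ?_
      refine (abs_add_le _ _).trans ?_
      simp only [Fin.mk_one] at *
      linarith

/-! ### Growth of harmonic numbers -/

theorem hn_le_one_add_log (M : ℕ) : hn M ≤ 1 + Real.log M := by
  refine le_trans (le_of_eq ?_) (harmonic_le_one_add_log M)
  simp [hn, harmonic]

theorem tendsto_hn_atTop : Tendsto hn atTop atTop :=
  Real.tendsto_sum_range_one_div_nat_succ_atTop

theorem isBigO_one_add_hn_log :
    (fun M : ℕ => 1 + hn M) =O[atTop] fun M : ℕ => Real.log M := by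
  have h : ∀ᶠ M : ℕ in atTop, 1 ≤ Real.log M :=
    (Real.tendsto_log_atTop.comp tendsto_natCast_atTop_atTop).eventually_ge_atTop 1
  refine Asymptotics.IsBigO.of_bound 3 ?_
  filter_upwards [h] with M hM
  have := hn_nonneg M
  have := hn_le_one_add_log M
  rw [Real.norm_of_nonneg (by linarith), Real.norm_of_nonneg (by linarith)]
  linarith

theorem tendsto_one_add_hn_pow_div (K : ℕ) :
    Tendsto (fun M : ℕ => (4 * (1 + hn M)) ^ K / ((M : ℝ) + 1)) atTop (𝓝 0) := by
  have h1 : (fun M : ℕ => (4 * (1 + hn M)) ^ K) =o[atTop] fun M : ℕ => (M : ℝ) :=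
    ((isBigO_one_add_hn_log.const_mul_left 4).pow K).trans_isLittleO
      (Real.isLittleO_pow_log_id_atTop.comp_tendsto tendsto_natCast_atTop_atTop)
  have h2 : (fun M : ℕ => (M : ℝ)) =O[atTop] fun M : ℕ => (M : ℝ) + 1 := by
    refine Asymptotics.IsBigO.of_bound 1 (Eventually.of_forall fun M => ?_)
    rw [Real.norm_of_nonneg (by positivity), Real.norm_of_nonneg (by positivity)]
    linarith
  exact (h1.trans_isBigO h2).tendsto_div_nhds_zero

theorem summable_hn_pow_div_sq (K : ℕ) :
    Summable fun i : ℕ => hn i ^ K / ((i : ℝ) + 1) ^ 2 := by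
  have h1 : (fun M : ℕ => hn M ^ K) =O[atTop] fun M : ℕ => (M : ℝ) ^ (1 / 2 : ℝ) := by
    have h0 : (fun M : ℕ => hn M) =O[atTop] fun M : ℕ => Real.log M := by
      refine Asymptotics.IsBigO.trans (Asymptotics.IsBigO.of_bound 1
        (Eventually.of_forall fun M => ?_)) isBigO_one_add_hn_log
      have := hn_nonneg M
      rw [Real.norm_of_nonneg this, Real.norm_of_nonneg (by linarith)]
      linarith
    have h2 := (isLittleO_log_rpow_rpow_atTop (K : ℝ) (by norm_num : (0 : ℝ) < 1 / 2)).isBigO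
    simp only [Real.rpow_natCast] at h2
    exact (h0.pow K).trans (h2.comp_tendsto tendsto_natCast_atTop_atTop)
  have h2 : (fun M : ℕ => (((M : ℝ) + 1) ^ 2)⁻¹) =O[atTop] fun M : ℕ => ((M : ℝ) ^ 2)⁻¹ := by
    refine Asymptotics.IsBigO.of_bound 1 ?_
    filter_upwards [eventually_gt_atTop 0] with M hM
    have : (0 : ℝ) < M := by exact_mod_cast hM
    rw [Real.norm_of_nonneg (by positivity), Real.norm_of_nonneg (by positivity), one_mul]
    gcongr
    linarith
  refine summable_of_isBigO_nat (Real.summable_nat_rpow.2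
    (by norm_num : (-(3 / 2) : ℝ) < -1)) ?_
  refine ((h1.mul h2).congr' (EventuallyEq.of_eq (funext fun M => (div_eq_mul_inv _ _).symm)) ?_)
  filter_upwards [eventually_gt_atTop 0] with M hM
  have : (0 : ℝ) < M := by exact_mod_cast hM
  rw [← Real.rpow_natCast, ← Real.rpow_neg this.le, ← Real.rpow_add this]
  norm_num

/-! ### Multiple zeta values as limits of multiple harmonic sums -/

open Classical in
/-- The strictly increasing `r`-tuples of positive integers at most `M`. -/
def tuples (r M : ℕ) : Finset (Fin r → ℕ) :=
  (Fintype.piFinset fun _ => Finset.range (M + 1)).filter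
    fun n => StrictMono n ∧ ∀ i, 0 < n i

theorem mem_tuples {r M : ℕ} {n : Fin r → ℕ} :
    n ∈ tuples r M ↔ (∀ i, n i ≤ M) ∧ StrictMono n ∧ ∀ i, 0 < n i := by
  simp [tuples]

theorem sum_tuples {r : ℕ} (g : Fin r → ℕ+) (M : ℕ) :
    ∑ n ∈ tuples r M, ∏ i, 1 / (n i : ℝ) ^ (g i : ℕ) = mhs (List.ofFn g).reverse M := by
  induction r generalizing M with
  | zero =>
    have : tuples 0 M = Finset.univ := Finset.eq_univ_of_forall fun n =>
      mem_tuples.2 ⟨fun i => i.elim0, fun i => i.elim0, fun i => i.elim0⟩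
    simp [this, mhs]
  | succ r ih =>
    rw [List.ofFn_succ', List.concat_eq_append, List.reverse_append, List.reverse_singleton,
      List.singleton_append, mhs]
    simp only [← ih, Finset.sum_div]
    rw [Finset.sum_sigma']
    symm
    refine Finset.sum_bij' (fun p _ => (Fin.snoc p.2 (p.1 + 1) : Fin (r + 1) → ℕ))
      (fun n _ => ⟨n (Fin.last r) - 1, Fin.init n⟩) ?_ ?_ ?_ ?_ ?_
    · rintro ⟨i, n⟩ h
      simp only [Finset.mem_sigma, Finset.mem_range, mem_tuples] at h
      obtain ⟨hi, h1, h2, h3⟩ := h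
      refine mem_tuples.2 ⟨fun j => ?_, fun j l hjl => ?_, fun j => ?_⟩
      · refine Fin.lastCases ?_ (fun j => ?_) j
        · simpa using hi
        · simpa using (h1 j).trans hi.le
      · induction j using Fin.lastCases with
        | last => exact absurd (Fin.le_last l) (not_le.2 hjl)
        | cast j =>
          induction l using Fin.lastCases with
          | last => simpa using Nat.lt_succ_iff.2 (h1 j)
          | cast l => simpa using h2 (Fin.castSucc_lt_castSucc_iff.1 hjl)
      · refine Fin.lastCases ?_ (fun j => ?_) j
        · simp
        · simpa using h3 j
    · intro n h
      obtain ⟨h1, h2, h3⟩ := mem_tuples.1 h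
      simp only [Finset.mem_sigma, Finset.mem_range, mem_tuples]
      have hl := h1 (Fin.last r)
      have hp := h3 (Fin.last r)
      refine ⟨by omega, fun j => ?_, fun j l hjl => h2 (Fin.castSucc_lt_castSucc_iff.2 hjl),
        fun j => h3 _⟩
      have : n j.castSucc < n (Fin.last r) := h2 (Fin.castSucc_lt_last j)
      simp only [Fin.init]
      omega
    · rintro ⟨i, n⟩ _
      simp
    · intro n h
      have := (mem_tuples.1 h).2.2 (Fin.last r)
      rw [Nat.sub_add_cancel this]
      exact Fin.snoc_init_self n
    · rintro ⟨i, n⟩ _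
      rw [Fin.prod_univ_castSucc]
      simp [div_eq_mul_inv]

/-- If the multiple harmonic sums converge, their limit is the multiple zeta value. -/
theorem zeta_eq_of_tendsto {k : List ℕ+} {z : ℝ}
    (h : Tendsto (fun M => mhs k.reverse M) atTop (𝓝 z)) : zeta k = z := by
  classical
  let f : {n : Fin k.length → ℕ // StrictMono n ∧ ∀ i, 0 < n i} → ℝ :=
    fun n => ∏ i, 1 / (n.1 i : ℝ) ^ (k.get i : ℕ)
  let s : ℕ → Finset {n : Fin k.length → ℕ // StrictMono n ∧ ∀ i, 0 < n i} :=
    fun M => (tuples k.length M).subtype _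
  have hs : Monotone s := fun a b hab n hn => by
    simp only [s, Finset.mem_subtype, mem_tuples] at hn ⊢
    exact ⟨fun i => (hn.1 i).trans hab, hn.2⟩
  have hmem : ∀ n, ∃ M, n ∈ s M := fun n => by
    refine ⟨∑ i, n.1 i, ?_⟩
    simp only [s, Finset.mem_subtype, mem_tuples]
    exact ⟨fun i => Finset.single_le_sum (f := n.1) (fun _ _ => Nat.zero_le _)
      (Finset.mem_univ i), n.2⟩
  have hsum : ∀ M, ∑ n ∈ s M, f n = mhs k.reverse M := fun M => by
    have := sum_tuples k.get M
    rw [List.ofFn_get] at this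
    rw [← this]
    exact Finset.sum_subtype_of_mem
      (f := fun n : Fin k.length → ℕ => ∏ i, 1 / (n i : ℝ) ^ (k.get i : ℕ))
      fun n hn => (mem_tuples.1 hn).2
  have hst : Tendsto s atTop atTop := tendsto_atTop_finset_of_monotone hs hmem
  have hf : 0 ≤ f := fun n => Finset.prod_nonneg fun i _ => by positivity
  have hmono : Monotone fun M => mhs k.reverse M := fun a b hab => by
    simp only [← hsum]
    exact Finset.sum_le_sum_of_subset_of_nonneg (hs hab) fun n _ _ => hf n
  have hsm : Summable f := by
    refine summable_of_sum_le (c := z) hf fun t => ?_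
    obtain ⟨M, hM⟩ := (hst.eventually_ge_atTop t).exists
    calc ∑ n ∈ t, f n ≤ ∑ n ∈ s M, f n :=
          Finset.sum_le_sum_of_subset_of_nonneg hM fun n _ _ => hf n
      _ ≤ z := by rw [hsum]; exact hmono.ge_of_tendsto h M
  have := hsm.hasSum.comp hst
  refine tendsto_nhds_unique (this.congr fun M => ?_) h
  exact hsum M

/-- The multiple harmonic sums of an admissible index converge to the multiple zeta value faster
than any power of the harmonic numbers diverges. -/
theorem tendsto_mhs_sub_zeta_mul {k : List ℕ+} (hk : Admissible k) (j : ℕ) :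
    Tendsto (fun M => (mhs k.reverse M - zeta k) * hn M ^ j) atTop (𝓝 0) := by
  rcases List.eq_nil_or_concat k with rfl | ⟨k, a, rfl⟩
  · have : zeta [] = 1 := zeta_eq_of_tendsto tendsto_const_nhds
    simp [this, mhs]
  have ha : 2 ≤ (a : ℕ) := by
    have : 1 < a := hk a (by simp)
    exact_mod_cast this
  rw [List.concat_eq_append]
  set g : ℕ → ℝ := fun i => mhs k.reverse i / ((i : ℝ) + 1) ^ (a : ℕ) with hg
  have hg0 : ∀ i, 0 ≤ g i := fun i => div_nonneg (mhs_nonneg _ _) (by positivity)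
  have hle : ∀ (l i : ℕ), g i * hn i ^ l ≤
      hn i ^ (k.reverse.length + l) / ((i : ℝ) + 1) ^ 2 := fun l i => by
    rw [hg, pow_add, div_mul_eq_mul_div]
    have := pow_nonneg (hn_nonneg i) l
    have := pow_nonneg (hn_nonneg i) k.reverse.length
    gcongr
    · exact mhs_le_hn_pow _ _
    · linarith [i.cast_nonneg (α := ℝ)]
  have hsum : ∀ l : ℕ, Summable fun i => g i * hn i ^ l := fun l =>
    Summable.of_nonneg_of_le (fun i => mul_nonneg (hg0 i) (pow_nonneg (hn_nonneg i) l)) (hle l)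
      (summable_hn_pow_div_sq _)
  have hgs : Summable g := by simpa using hsum 0
  have hmhs : ∀ M, mhs (k ++ [a]).reverse M = ∑ i ∈ Finset.range M, g i := fun M => by
    rw [List.reverse_append, List.reverse_singleton, List.singleton_append, mhs]
  have hz : zeta (k ++ [a]) = ∑' i, g i :=
    zeta_eq_of_tendsto (by simpa only [hmhs] using hgs.hasSum.tendsto_sum_nat)
  -- The tail of `∑ g i` times `hn M ^ j` is dominated by the tail of `∑ g i * hn i ^ j`.
  have htail := tendsto_sum_nat_add fun i => g i * hn i ^ j
  refine squeeze_zero_norm (fun M => ?_) htail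
  have h1 : zeta (k ++ [a]) - mhs (k ++ [a]).reverse M = ∑' i, g (i + M) := by
    rw [hz, hmhs, ← hgs.sum_add_tsum_nat_add M, add_sub_cancel_left]
  rw [Real.norm_eq_abs, abs_mul, abs_sub_comm, h1, abs_of_nonneg (tsum_nonneg fun i => hg0 _),
    abs_of_nonneg (pow_nonneg (hn_nonneg M) j), ← tsum_mul_right]
  refine Summable.tsum_le_tsum (fun i => ?_)
    (((summable_nat_add_iff M).2 hgs).mul_right _)
    ((summable_nat_add_iff (f := fun i => g i * hn i ^ j) M).2 (hsum j))
  gcongr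
  · exact hg0 _
  · exact hn_nonneg M
  · exact hn_mono (by omega)

/-! ### The double shuffle relation for regularized values -/

theorem flatLin_coe_H1 (M : ℕ) (x : H1) : flatLin M M (x : Hoff) = evalH M x := by
  have : (flatLin M M ∘ₗ H1.subtype) = evalH M := basisH1.ext fun k => by
    rw [LinearMap.comp_apply, Submodule.subtype_apply, coe_basisH1, eIdx_eq_word, flatLin_word,
      evalH_basis, mhs_eq_flat]
  exact LinearMap.congr_fun this x

/-- The multiple harmonic sums satisfy the shuffle relation asymptotically, if one of the factors
is in `𝔥⁰`. -/
theorem tendsto_flatLin_sub_sh {x y : Hoff} (hx : x ∈ H1) (hy : y ∈ H0) :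
    Tendsto (fun M => flatLin M M x * flatLin M M y - flatLin M M (sh x y)) atTop (𝓝 0) := by
  rw [H1_eq_span] at hx
  rw [H0_eq_span] at hy
  induction hy using Submodule.span_induction with
  | mem y hy =>
    obtain ⟨l, hl, rfl⟩ := hy
    induction hx using Submodule.span_induction with
    | mem x hx =>
      obtain ⟨k, rfl⟩ := hx
      rw [eIdx_eq_word, eIdx_eq_word]
      simp only [flatLin_word, sh_word]
      change Tendsto (fun M => shDefect M (idxLetters k).reverse (idxLetters l).reverse M) _ _
      rcases List.eq_nil_or_concat l with rfl | ⟨l, a, rfl⟩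
      · simp [idxLetters, shDefect_nil_right]
      · have ha : 1 < a := hl a (by simp)
        obtain ⟨v, hv⟩ : ∃ v, (idxLetters (l ++ [a])).reverse = 0 :: v := by
          have : (a : ℕ) - 1 = (a - 2 : ℕ) + 1 := by
            have : 1 < (a : ℕ) := by exact_mod_cast ha
            omega
          rw [idxLetters_concat_reverse, this, List.replicate_succ, List.cons_append]
          exact ⟨_, rfl⟩
        have hs := startsE1_idxLetters (l ++ [a])
        rw [List.concat_eq_append]
        rw [hv] at hs ⊢
        exact squeeze_zero_norm
          (fun M => abs_shDefect_zero_le _ v (startsE1_idxLetters k) hs le_rfl)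
          (tendsto_one_add_hn_pow_div _)
    | zero => simp
    | add x z _ _ h1 h2 =>
      have := h1.add h2
      rw [add_zero] at this
      refine this.congr fun M => ?_
      simp only [map_add, LinearMap.add_apply]
      ring
    | smul c x _ h =>
      have := h.const_mul (c : ℝ)
      rw [mul_zero] at this
      refine this.congr fun M => ?_
      simp only [map_smul, LinearMap.smul_apply, Rat.smul_def]
      ring
  | zero => simp
  | add y z _ _ h1 h2 =>
    have := h1.add h2
    rw [add_zero] at this
    refine this.congr fun M => ?_
    simp only [map_add]
    ring
  | smul c y _ h =>
    have := h.const_mul (c : ℝ)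
    rw [mul_zero] at this
    refine this.congr fun M => ?_
    simp only [map_smul, Rat.smul_def]
    ring

theorem tendsto_evalStar_sub_Z_mul (c : H0Star) (j : ℕ) :
    Tendsto (fun M => (evalStar M c - Z c) * hn M ^ j) atTop (𝓝 0) := by
  obtain ⟨x, hx⟩ := c
  change Tendsto (fun M => (evalH M x - basisH1.constr ℚ zeta x) * hn M ^ j) atTop (𝓝 0)
  have key : ∀ y ∈ Submodule.span ℚ (eIdx '' {k | Admissible k}), ∀ x : H1, (x : Hoff) = y →
      Tendsto (fun M => (evalH M x - basisH1.constr ℚ zeta x) * hn M ^ j) atTop (𝓝 0) := by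
    intro y hy
    induction hy using Submodule.span_induction with
    | mem y hy =>
      obtain ⟨k, hk, rfl⟩ := hy
      intro x hx
      obtain rfl : x = basisH1 k := Subtype.ext (hx.trans (coe_basisH1 k).symm)
      simp only [evalH_basis, Module.Basis.constr_basis]
      exact tendsto_mhs_sub_zeta_mul hk j
    | zero =>
      intro x hx
      obtain rfl : x = 0 := Subtype.ext hx
      simp
    | add y z hy hz h1 h2 =>
      intro x hx
      have hle := H0_eq_span ▸ H0_le_H1
      obtain rfl : x = ⟨y, hle hy⟩ + ⟨z, hle hz⟩ := Subtype.ext hx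
      have := (h1 ⟨y, hle hy⟩ rfl).add (h2 ⟨z, hle hz⟩ rfl)
      rw [add_zero] at this
      refine this.congr fun M => ?_
      simp only [map_add]
      ring
    | smul c y hy h =>
      intro x hx
      have hle := H0_eq_span ▸ H0_le_H1
      obtain rfl : x = c • (⟨y, hle hy⟩ : H1) := Subtype.ext hx
      have := (h ⟨y, hle hy⟩ rfl).const_mul (c : ℝ)
      rw [mul_zero] at this
      refine this.congr fun M => ?_
      simp only [map_smul, Rat.smul_def]
      ring
  exact key _ (H0_eq_span ▸ hx) x rfl

theorem evalStar_eq_sum (M : ℕ) (p : Polynomial H0Star) :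
    evalStar M (fromPoly p) = p.sum fun j c => evalStar M c * hn M ^ j := by
  rw [fromPoly, Polynomial.aeval_eq_sum_range, Polynomial.sum_over_range _ (by simp), map_sum]
  refine Finset.sum_congr rfl fun j _ => ?_
  rw [Algebra.smul_def, map_mul, map_pow, evalStar_e1]
  rfl

/-- If the multiple harmonic sums of `x ∈ 𝔥¹` tend to zero, then the regularized value of `x`
vanishes: they are asymptotic to a real polynomial in the harmonic numbers, whose constant term is
the regularized value. -/
theorem Z_regStar_eq_zero {x : H1Star}
    (hx : Tendsto (fun M => evalStar M x) atTop (𝓝 0)) : Z (regStar x) = 0 := by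
  set p := polyEquiv.symm x with hp
  have hpx : fromPoly p = x := polyEquiv.apply_symm_apply x
  have hreg : regStar x = p.coeff 0 := by
    change Polynomial.aeval (0 : H0Star) p = _
    rw [Polynomial.coe_aeval_eq_eval, Polynomial.coeff_zero_eq_eval_zero]
  let q : Polynomial ℝ :=
    ∑ j ∈ Finset.range (p.natDegree + 1), Polynomial.monomial j (Z (p.coeff j))
  have hq : Tendsto (fun M => q.eval (hn M)) atTop (𝓝 0) := by
    have h := tendsto_finsetSum (Finset.range (p.natDegree + 1)) fun j _ =>
      tendsto_evalStar_sub_Z_mul (p.coeff j) j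
    rw [Finset.sum_const_zero] at h
    have h' := hx.sub h
    rw [sub_zero] at h'
    refine h'.congr fun M => ?_
    rw [← hpx, evalStar_eq_sum, Polynomial.sum_over_range _ (by simp)]
    simp only [q, Polynomial.eval_finsetSum, Polynomial.eval_monomial, sub_mul,
      Finset.sum_sub_distrib, sub_sub_cancel]
  have hq0 : q = 0 := by
    by_contra hne
    rcases lt_or_ge 0 q.degree with hd | hd
    · have h1 := (q.abs_tendsto_atTop hd).comp tendsto_hn_atTop
      exact not_tendsto_nhds_of_tendsto_atTop h1 _ hq.abs
    · rw [Polynomial.eq_C_of_degree_le_zero hd] at hq hne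
      simp only [Polynomial.eval_C, tendsto_const_nhds_iff] at hq
      rw [hq, Polynomial.C_0] at hne
      exact hne rfl
  have hc : q.coeff 0 = Z (p.coeff 0) := by
    simp [q, Polynomial.finsetSum_coeff, Polynomial.coeff_monomial]
  rw [hreg, ← hc, hq0, Polynomial.coeff_zero]

end MZV

end

/-- The harmonic-regularized extended double shuffle relation. -/
theorem mainTheorem1 (w₁ w₀ : MZV.H1) (hw₀ : (w₀ : MZV.Hoff) ∈ MZV.H0) :
    MZV.Z (MZV.regStar (MZV.toStar (MZV.harm w₁ w₀ - MZV.shH1 w₁ w₀))) = 0 := by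
  refine MZV.Z_regStar_eq_zero ?_
  refine (MZV.tendsto_flatLin_sub_sh w₁.2 hw₀).congr fun M => ?_
  change _ = MZV.evalH M (MZV.harm w₁ w₀ - MZV.shH1 w₁ w₀)
  rw [map_sub, MZV.evalH_harm, ← MZV.flatLin_coe_H1, ← MZV.flatLin_coe_H1, ← MZV.flatLin_coe_H1]
  rfl
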